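/- For $A\in\mathbb{C}$ let $\Pi_A^\circ=\{(\lambda,w)\in\mathbb{C}^2 : w^2=\lambda^4-A\lambda^2+1,\ \lambda\neq 0\}$. For $A\neq\pm2$ this is the elliptic curve $\Pi_A$ of $w^2=\lambda^4-A\lambda^2+1$ without the points over $\lambda=0,\infty$, which are the poles, all with zero residue, of the differential $w\lambda^{-2}d\lambda$; for $A=\pm 2$ it is the corresponding degenerate (nodal) curve, whose two sheets meet at the double roots. A cycle is a closed $C^1$ path $\mathbf{c}$ on $\Pi_A^\circ$, that is, a $C^1$ map $t\mapsto(\lambda(t),w(t))$ from $[0,1]$ to $\mathbb{C}^2$ with values in $\Pi_A^\circ$ and equal values at $t=0$ and $t=1$; it may change sheets at branch points and at nodes. For $\phi\in\mathbb{R}$ we say that $A\in\mathbb{C}$ solves the Boutroux equations $(\mathrm{BE})_\phi$ if $$\operatorname{Im}\Bigl(e^{i\phi}\int_{\mathbf{c}}\frac{w}{\lambda^2}\,d\lambda\Bigr)=0\qquad\text{for every cycle } \mathbf{c} \text{ on } \Pi_A^\circ .$$ **Proposition.** There is a function $\mathbb{R}\to\mathbb{C}$, $\phi\mapsto A_\phi$,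 with the following properties. 1. For each $\phi\in\mathbb{R}$, $A_\phi$ is the unique solution in $\mathbb{C}$ of $(\mathrm{BE})_\phi$. 2. $A_{\phi\pm\pi/2}=-A_\phi$, $A_{\phi+\pi}=A_\phi$ and $A_{-\phi}=\overline{A_\phi}$ for all $\phi\in\mathbb{R}$. 3. $A_0=2$ and $A_{\pm\pi/2}=-2$. 4. $\phi\mapsto A_\phi$ is continuous on $\mathbb{R}$ and $C^\infty$ on $\mathbb{R}\setminus\{m\pi/2 : m\in\mathbb{Z}\}$. -/

import Mathlib

open scoped ContDiff

noncomputable section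

namespace Boutroux

/-- The curve `w² = λ⁴ - A λ² + 1` of pairs `(λ, w)`, with the poles of the differential
`w / λ² dλ` removed: the two points over `λ = ∞` (the curve is affine) and the two points over
`λ = 0`. For `A ≠ ± 2` this is the elliptic curve (as a Riemann surface) minus these four points.
For `A = ± 2` it is the degenerate (nodal) curve minus these points, and the two sheets
meet at the double roots. -/
def curve (A : ℂ) : Set (ℂ × ℂ) :=
  {p | p.2 ^ 2 = p.1 ^ 4 - A * p.1 ^ 2 + 1 ∧ p.1 ≠ 0}

/-- A cycle: a closed `C¹` path on the curve. Piecewise `C¹` loops become `C¹` after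
a reparametrisation that stops at the corners, and in the degenerate case a loop may change
sheets at a node. Integrals over homology cycles are integer combinations of integrals over such
loops. The differential `w / λ² dλ` has zero residue at each of its four poles, so removing the
poles from the curve adds no period. -/
structure Cycle (A : ℂ) where
  /-- the base point of the loop -/
  base : ℂ × ℂ
  /-- the loop, in the coordinates `(λ, w)` -/
  path : Path base base
  mem_curve : ∀ t, path t ∈ curve A
  contDiffOn : ContDiffOn ℝ 1 path.extend (Set.Icc 0 1)

/-- The differential `w / λ² dλ`, as a 1-form in the coordinates `(λ, w)`. -/
def form (p : ℂ × ℂ) : ℂ × ℂ →L[ℂ] ℂ :=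
  (p.2 / p.1 ^ 2) • ContinuousLinearMap.fst ℂ ℂ ℂ

/-- The integral of `w(A, λ) / λ² dλ` over a cycle. -/
def Cycle.integral {A : ℂ} (c : Cycle A) : ℂ :=
  ∫ᶜ p in c.path, form p

/-- The Boutroux equations with angle `φ`, as equations for `A`:
`Im (e^{iφ} ∫_c w(A, λ) / λ² dλ) = 0` for every cycle `c`. -/
def Solves (φ : ℝ) (A : ℂ) : Prop :=
  ∀ c : Cycle A, (Complex.exp (Complex.I * (φ : ℂ)) * c.integral).im = 0

end Boutroux

end

open scoped ContDiff

noncomputable section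

namespace Boutroux

open Complex MeasureTheory Set Filter Topology intervalIntegral

/-! Write A = 2 - 4m. In the coordinates x = (2 - λ² - λ⁻²)/4 and y with y² = 4x(1-x)(m-x), the
differential w λ⁻² dλ becomes 2i(m-x)/y dx. The Boutroux equations then amount to two real equations
(`IsSol`): e^{iφ} `action m` is imaginary and e^{iφ} `action (1 - m)` is real.

Necessity comes from explicit loops. `exists_cycle_integral_eq` realises i `action m` as a period,
and the rotation λ ↦ iλ, which exchanges m with 1 - m and shifts φ by π/2, gives the second
equation. For m < 0 the unit circle adds a nonzero real period; for m = 0 a loop changing sheets at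
the nodes does. With the rotation this confines real m to [0, 1].

Sufficiency avoids homology. Near each branch point 0, m, 1 there is a primitive y f(x) with f
analytic. Where two of them overlap, the square of their difference is constant, namely ∓1/16 times
the square of one of the two actions. The real equations say exactly that the rotated imaginary
parts agree, so they glue to one function `height`, a primitive of the real 1-form along every cycle
(`solves_of_action`). The gluing uses that m lies in the open disc with diameter [0, 1]. The nodal
curve is treated separately by `solves_zero_two`.

Solutions are located by arguments (`exists_angle`): for 0 ≤ φ ≤ π/2 a nonreal solution lies in
`triangle φ`, inside that disc, and 0 < φ < π/2. There the derivatives of the two actions, rotated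
by e^{-iφ/2}, lie in the open fourth quadrant. Their arguments thus differ by less than π/2, which
makes the linearised equations nondegenerate (`eq_zero_of_quadrant`). Averaged over a segment in the
convex triangle this gives uniqueness; at a point it gives the implicit function theorem, hence
smoothness.

For existence, at φ = π/4 the two equations coincide on Re m = 1/2 and the intermediate value
theorem applies; the set of solvable angles is open by the local branch and closed in (0, π/2) by
compactness. The endpoints have m = 0 and m = 1. Compactness and uniqueness give continuity on [0,
π/2], and rotation and conjugation extend everything to ℝ. -/

theorem ne_zero_of_im_ne_zero {m : ℂ} (hm : m.im ≠ 0) : m ≠ 0 := fun h => hm (by rw [h, zero_im])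

theorem one_sub_ne_zero_of_im_ne_zero {m : ℂ} (hm : m.im ≠ 0) : 1 - m ≠ 0 :=
  ne_zero_of_im_ne_zero (by simpa using hm)

/-! ### The principal square root -/

theorem csqrt_sq (z : ℂ) : z.sqrt ^ 2 = z := by
  rw [Complex.sqrt]
  exact Complex.cpow_ofNat_inv_pow z 2

theorem csqrt_mul_self (z : ℂ) : z.sqrt * z.sqrt = z := by
  rw [← sq, csqrt_sq]

theorem csqrt_ne_zero {z : ℂ} (hz : z ≠ 0) : z.sqrt ≠ 0 := fun h => hz <| by
  rw [← csqrt_sq z, h]; simp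

theorem csqrt_re_pos {z : ℂ} (hz : z ∈ slitPlane) : 0 < z.sqrt.re := by
  rw [Complex.sqrt, cpow_inv_two_re]
  apply Real.sqrt_pos.2
  rcases hz with h | h
  · have := norm_nonneg z; linarith
  · have := (abs_re_lt_norm (z := z)).2 h
    have := neg_abs_le z.re
    linarith

theorem norm_csqrt (z : ℂ) : ‖z.sqrt‖ = √‖z‖ := by
  rw [eq_comm, Real.sqrt_eq_iff_mul_self_eq (norm_nonneg _) (norm_nonneg _), ← norm_mul,
    csqrt_mul_self]

theorem hasDerivAt_csqrt {z : ℂ} (hz : z ∈ slitPlane) :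
    HasDerivAt Complex.sqrt (1 / (2 * z.sqrt)) z := by
  have h := (hasDerivAt_id z).cpow_const (c := 2⁻¹) hz
  have hz0 := slitPlane_ne_zero hz
  have e : z ^ ((2 : ℂ)⁻¹ - 1) = (z.sqrt)⁻¹ := by
    rw [cpow_sub _ _ hz0, cpow_one, Complex.sqrt]
    have := csqrt_sq z
    rw [Complex.sqrt] at this
    have h0 := csqrt_ne_zero hz0
    rw [Complex.sqrt] at h0
    generalize z ^ (2⁻¹ : ℂ) = s at this h0
    rw [← this]
    field_simp
  simp only [id] at h
  rw [e] at h
  refine h.congr_deriv ?_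
  rw [mul_one, ← mul_inv, one_div]

theorem HasDerivAt.csqrt {f : ℂ → ℂ} {f' x : ℂ} (hf : HasDerivAt f f' x)
    (hx : f x ∈ slitPlane) :
    HasDerivAt (fun x => (f x).sqrt) (f' / (2 * (f x).sqrt)) x := by
  refine ((hasDerivAt_csqrt hx).comp x hf).congr_deriv ?_
  rw [one_div, mul_comm, div_eq_mul_inv]

theorem contDiffAt_csqrt {z : ℂ} (hz : z ∈ slitPlane) {n : WithTop ℕ∞} :
    ContDiffAt ℂ n Complex.sqrt z := by
  have : Complex.sqrt =ᶠ[𝓝 z] fun w => exp (log w / 2) := by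
    filter_upwards [isOpen_slitPlane.mem_nhds hz] with w hw
    exact sqrt_eq_exp (slitPlane_ne_zero hw)
  exact (((contDiffAt_log hz).div_const _).cexp).congr_of_eventuallyEq this

theorem continuousAt_csqrt {z : ℂ} (hz : z ∈ slitPlane) : ContinuousAt Complex.sqrt z :=
  (hasDerivAt_csqrt hz).continuousAt

theorem csqrt_conj {z : ℂ} (hz : z ∈ slitPlane) :
    (starRingEnd ℂ z).sqrt = starRingEnd ℂ z.sqrt := by
  rw [Complex.sqrt, Complex.sqrt, conj_cpow _ _ (slitPlane_arg_ne_pi hz), map_inv₀, conj_ofNat]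

theorem csqrt_ofReal {x : ℝ} (hx : 0 ≤ x) : (x : ℂ).sqrt = (√x : ℝ) := by
  rw [sqrt_of_nonneg (by exact_mod_cast hx)]; simp

theorem csqrt_im_nonneg {z : ℂ} (hz : 0 ≤ z.im) : 0 ≤ z.sqrt.im := by
  rw [Complex.sqrt, cpow_inv_two_im_eq_sqrt hz]; positivity

theorem csqrt_im_nonpos {z : ℂ} (hz : z.im ≤ 0) (h : z ∈ slitPlane) : z.sqrt.im ≤ 0 := by
  have h1 := csqrt_im_nonneg (z := starRingEnd ℂ z) (by simpa using hz)
  rw [csqrt_conj h] at h1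
  simpa using h1

theorem csqrt_im_neg {z : ℂ} (hz : z.im < 0) : z.sqrt.im < 0 := by
  have hs : z ∈ slitPlane := Or.inr hz.ne
  refine lt_of_le_of_ne (csqrt_im_nonpos hz.le hs) fun h => hz.ne ?_
  have := congrArg im (csqrt_sq z)
  simp [sq, h] at this
  exact this.symm

/-! ### Weighted means along segments -/

/-- Differentiation under the integral sign over a compact interval. -/
theorem hasDerivAt_integral_of_continuousOn {U : Set ℂ} (hU : IsOpen U) {a b : ℝ}
    {F F' : ℂ → ℝ → ℂ} (hF : ∀ z ∈ U, ContinuousOn (F z) (uIcc a b))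
    (hF' : ContinuousOn (Function.uncurry F') (U ×ˢ uIcc a b))
    (hd : ∀ z ∈ U, ∀ t ∈ uIcc a b, HasDerivAt (F · t) (F' z t) z) {z : ℂ} (hz : z ∈ U) :
    HasDerivAt (fun z => ∫ t in a..b, F z t) (∫ t in a..b, F' z t) z := by
  obtain ⟨ε, hε, hball⟩ := Metric.nhds_basis_closedBall.mem_iff.1 (hU.mem_nhds hz)
  have hK : IsCompact (Metric.closedBall z ε ×ˢ uIcc a b) :=
    (isCompact_closedBall z ε).prod isCompact_uIcc
  obtain ⟨M, hM⟩ := hK.exists_bound_of_continuousOn (hF'.mono (prod_mono hball le_rfl))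
  have hsub : uIoc a b ⊆ uIcc a b := uIoc_subset_uIcc
  have hc' : ContinuousOn (F' z) (uIcc a b) :=
    hF'.comp (f := fun t => (z, t)) (by fun_prop) fun t ht => ⟨hz, ht⟩
  refine (hasDerivAt_integral_of_dominated_loc_of_deriv_le (bound := fun _ => M)
    (Metric.closedBall_mem_nhds z hε) ?_ (hF z hz).intervalIntegrable ?_ ?_ ?_ ?_).2
  · filter_upwards [hU.mem_nhds hz] with w hw
    exact ((hF w hw).mono hsub).aestronglyMeasurable measurableSet_uIoc
  · exact (hc'.mono hsub).aestronglyMeasurable measurableSet_uIoc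
  · exact ae_of_all _ fun t ht w hw => hM (w, t) ⟨hw, hsub ht⟩
  · exact intervalIntegrable_const
  · exact ae_of_all _ fun t ht w hw => hd w (hball hw) t (hsub ht)

/-- The weighted mean `∫₀¹ rᵏ F (c + r² (z - c)) dr` of `F` along the segment from `c` to `z`. -/
def radialMean (k : ℕ) (c : ℂ) (F : ℂ → ℂ) (z : ℂ) : ℂ :=
  ∫ r in (0 : ℝ)..1, (r : ℂ) ^ k * F (c + (r : ℂ) ^ 2 * (z - c))

theorem sq_mem_segment {U : Set ℂ} {c : ℂ} (hs : StarConvex ℝ c U) {z : ℂ} (hz : z ∈ U)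
    {r : ℝ} (hr : r ∈ uIcc (0 : ℝ) 1) : c + (r : ℂ) ^ 2 * (z - c) ∈ U := by
  rw [uIcc_of_le zero_le_one] at hr
  have := hs.add_smul_sub_mem hz (sq_nonneg r) (pow_le_one₀ hr.1 hr.2)
  simpa using this

/-- The equation is the Euler-type identity obtained by integrating d/dr of r^(k+1) F(c + r²(z - c))
over [0, 1]. Squaring r absorbs the square-root behaviour at a branch point c, so that the mean
itself is analytic there. -/
theorem exists_hasDerivAt_radialMean {U : Set ℂ} (hU : IsOpen U) {c : ℂ}
    (hs : StarConvex ℝ c U) (k : ℕ) {F : ℂ → ℂ} (hF : DifferentiableOn ℂ F U) {z : ℂ}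
    (hz : z ∈ U) :
    ∃ N' : ℂ, HasDerivAt (radialMean k c F) N' z ∧
      2 * (z - c) * N' + (k + 1) * radialMean k c F z = F z := by
  have hdF : ContinuousOn (deriv F) U := (hF.deriv hU).continuousOn
  have hder : ∀ w ∈ U, ∀ r ∈ uIcc (0 : ℝ) 1,
      HasDerivAt F (deriv F (c + (r : ℂ) ^ 2 * (w - c))) (c + (r : ℂ) ^ 2 * (w - c)) :=
    fun w hw r hr => (hF.differentiableAt (hU.mem_nhds (sq_mem_segment hs hw hr))).hasDerivAt
  have key := hasDerivAt_integral_of_continuousOn hU (a := 0) (b := 1)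
    (F := fun w r => (r : ℂ) ^ k * F (c + (r : ℂ) ^ 2 * (w - c)))
    (F' := fun w r => (r : ℂ) ^ k * (deriv F (c + (r : ℂ) ^ 2 * (w - c)) * (r : ℂ) ^ 2))
    (fun w hw => by
      refine ContinuousOn.mul (by fun_prop) (hF.continuousOn.comp (by fun_prop) ?_)
      exact fun r hr => sq_mem_segment hs hw hr)
    (by
      refine ContinuousOn.mul (by fun_prop) (ContinuousOn.mul (hdF.comp (by fun_prop) ?_)
        (by fun_prop))
      exact fun p hp => sq_mem_segment hs hp.1 hp.2)
    (fun w hw r hr => by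
      refine HasDerivAt.const_mul _ (HasDerivAt.comp w (hder w hw r hr) ?_)
      simpa using (((hasDerivAt_id w).sub_const c).const_mul ((r : ℂ) ^ 2)).const_add c) hz
  refine ⟨_, key, ?_⟩
  have hc1 : ContinuousOn (fun r : ℝ => F (c + (r : ℂ) ^ 2 * (z - c))) (uIcc 0 1) :=
    hF.continuousOn.comp (by fun_prop) fun r hr => sq_mem_segment hs hz hr
  have hc2 : ContinuousOn (fun r : ℝ => deriv F (c + (r : ℂ) ^ 2 * (z - c))) (uIcc 0 1) :=
    hdF.comp (by fun_prop) fun r hr => sq_mem_segment hs hz hr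
  have ftc := integral_eq_sub_of_hasDerivAt (a := 0) (b := 1)
    (f := fun r : ℝ => (r : ℂ) ^ (k + 1) * F (c + (r : ℂ) ^ 2 * (z - c)))
    (f' := fun r : ℝ => (k + 1) * ((r : ℂ) ^ k * F (c + (r : ℂ) ^ 2 * (z - c))) +
      2 * (z - c) * ((r : ℂ) ^ k * (deriv F (c + (r : ℂ) ^ 2 * (z - c)) * (r : ℂ) ^ 2)))
    (fun r hr => by
      have h1 : HasDerivAt (fun r : ℝ => (r : ℂ)) 1 r := (hasDerivAt_id r).ofReal_comp
      have h2 := (h1.pow (k + 1)).mul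
        ((hder z hz r hr).comp r (((h1.pow 2).mul_const (z - c)).const_add c))
      refine h2.congr_deriv ?_
      simp
      ring)
    (by
      refine ContinuousOn.intervalIntegrable (ContinuousOn.add ?_ ?_)
      · exact continuousOn_const.mul (ContinuousOn.mul (by fun_prop) hc1)
      · exact continuousOn_const.mul (ContinuousOn.mul (by fun_prop)
          (hc2.mul (by fun_prop))))
  rw [intervalIntegral.integral_add, intervalIntegral.integral_const_mul,
    intervalIntegral.integral_const_mul] at ftc
  · rw [add_comm]
    simpa [radialMean] using ftc
  · refine ContinuousOn.intervalIntegrable ?_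
    exact continuousOn_const.mul (ContinuousOn.mul (by fun_prop) hc1)
  · refine ContinuousOn.intervalIntegrable ?_
    exact continuousOn_const.mul (ContinuousOn.mul (by fun_prop) (hc2.mul (by fun_prop)))

/-! ### Analytic charts at the branch points -/

/-- `f` solves the equation `2 q f' + q' f = i (m - z)` at `z`, where `q = z (1 - z) (m - z)`.
Then `2 √q f` is a primitive of the differential in the coordinate `z`. -/
def IsChart (m : ℂ) (f : ℂ → ℂ) (z : ℂ) : Prop :=
  ∃ f' : ℂ, HasDerivAt f f' z ∧
    2 * (z * (1 - z) * (m - z)) * f' + ((1 - 2 * z) * (m - z) - z * (1 - z)) * f z = I * (m - z)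

/-- The action integral between the turning points. -/
def action (m : ℂ) : ℂ :=
  ∫ t in (0 : ℝ)..(Real.pi / 2),
    8 * m * (Real.cos t : ℂ) ^ 2 / Complex.sqrt (1 - m * (Real.sin t : ℂ) ^ 2)

/-- The chart based at the branch point `0`. -/
def chartZero (m z : ℂ) : ℂ :=
  I * radialMean 0 0 (fun x => (1 - x / m).sqrt / (1 - x).sqrt) z /
    ((1 - z / m).sqrt * (1 - z).sqrt)

/-- The chart based at the branch point `m`. -/
def chartSelf (m z : ℂ) : ℂ :=
  I * (z - m) * radialMean 2 m (fun x => 1 / ((x / m).sqrt * ((1 - x) / (1 - m)).sqrt)) z /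
    (m * (1 - m) * ((z / m).sqrt * ((1 - z) / (1 - m)).sqrt))

/-- For m ≠ 0, the plane without the ray from m away from 0 and the ray from 1 away from 0. -/
def domainZero (m : ℂ) : Set ℂ := {z | 1 - z / m ∈ slitPlane ∧ 1 - z ∈ slitPlane}

/-- For m ≠ 0, 1, the plane without the two rays from 0 and from 1 that point away from m. -/
def domainSelf (m : ℂ) : Set ℂ := {z | z / m ∈ slitPlane ∧ (1 - z) / (1 - m) ∈ slitPlane}

theorem isOpen_domainZero (m : ℂ) : IsOpen (domainZero m) :=
  (isOpen_slitPlane.preimage (f := fun z : ℂ => 1 - z / m) (by fun_prop)).inter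
    (isOpen_slitPlane.preimage (f := fun z : ℂ => 1 - z) (by fun_prop))

theorem isOpen_domainSelf (m : ℂ) : IsOpen (domainSelf m) :=
  (isOpen_slitPlane.preimage (f := fun z : ℂ => z / m) (by fun_prop)).inter
    (isOpen_slitPlane.preimage (f := fun z : ℂ => (1 - z) / (1 - m)) (by fun_prop))

theorem starConvex_domainZero (m : ℂ) : StarConvex ℝ 0 (domainZero m) := by
  rintro z ⟨h1, h2⟩ a b ha hb hab
  have hab' : (a : ℂ) + b = 1 := by exact_mod_cast hab
  constructor
  · convert starConvex_one_slitPlane h1 ha hb hab using 1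
    simp only [real_smul]
    linear_combination -hab'
  · convert starConvex_one_slitPlane h2 ha hb hab using 1
    simp only [real_smul]
    linear_combination -hab'

theorem starConvex_domainSelf {m : ℂ} (hm : m ≠ 0) (hm1 : 1 - m ≠ 0) :
    StarConvex ℝ m (domainSelf m) := by
  rintro z ⟨h1, h2⟩ a b ha hb hab
  have hab' : (a : ℂ) + b = 1 := by exact_mod_cast hab
  constructor
  · convert starConvex_one_slitPlane h1 ha hb hab using 1
    simp only [real_smul]
    field_simp
  · convert starConvex_one_slitPlane h2 ha hb hab using 1
    simp only [real_smul]
    field_simp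
    linear_combination -hab'

/-- Up to the square-root factors this is the equation of `radialMean` with k = 0: the differential
behaves like z^(-1/2) at 0, and dz = 2r dr cancels that factor. At m it vanishes like (m - z)^(1/2),
whence k = 2 in `chartSelf`. -/
theorem isChart_chartZero {m z : ℂ} (hm : m ≠ 0) (hz : z ∈ domainZero m) :
    IsChart m (chartZero m) z := by
  have d1 : ∀ x ∈ domainZero m, HasDerivAt (fun x : ℂ => (1 - x / m).sqrt)
      (-(1 / m) / (2 * (1 - x / m).sqrt)) x := fun x hx =>
    HasDerivAt.csqrt (((hasDerivAt_id' x).div_const m).const_sub 1) hx.1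
  have d2 : ∀ x ∈ domainZero m, HasDerivAt (fun x : ℂ => (1 - x).sqrt)
      (-1 / (2 * (1 - x).sqrt)) x := fun x hx =>
    HasDerivAt.csqrt ((hasDerivAt_id' x).const_sub 1) hx.2
  obtain ⟨N', hN', hN⟩ := exists_hasDerivAt_radialMean (isOpen_domainZero m)
    (starConvex_domainZero m) 0 (F := fun x => (1 - x / m).sqrt / (1 - x).sqrt)
    (fun x hx => ((d1 x hx).differentiableAt.div (d2 x hx).differentiableAt
      (csqrt_ne_zero (slitPlane_ne_zero hx.2))).differentiableWithinAt) hz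
  have ha := csqrt_ne_zero (slitPlane_ne_zero hz.1)
  have hb := csqrt_ne_zero (slitPlane_ne_zero hz.2)
  refine ⟨_, (hN'.const_mul I).div ((d1 z hz).mul (d2 z hz)) (mul_ne_zero ha hb), ?_⟩
  have ha2 := csqrt_sq (1 - z / m)
  have hb2 := csqrt_sq (1 - z)
  simp only [chartZero] at hN ⊢
  generalize radialMean 0 0 _ z = N at *
  generalize (1 - z / m).sqrt = a at *
  generalize (1 - z).sqrt = b at *
  have hz1 : z = 1 - b ^ 2 := by linear_combination hb2
  have hma : m - z = m * a ^ 2 := by rw [ha2]; field_simp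
  rw [hma]
  have hN2 : a = b * (2 * z * N' + N) := by
    rw [eq_div_iff hb] at hN
    simp only [Nat.cast_zero] at hN
    linear_combination -hN
  rw [show 1 - z = b ^ 2 from hb2.symm]
  clear hN ha2 hma hb2
  field_simp
  subst hz1
  linear_combination (-(b * m * a ^ 2)) * hN2

theorem chartSelf_self (m : ℂ) : chartSelf m m = 0 := by simp [chartSelf]

theorem isChart_chartSelf {m z : ℂ} (hm : m ≠ 0) (hm1 : 1 - m ≠ 0) (hz : z ∈ domainSelf m) :
    IsChart m (chartSelf m) z := by
  have d1 : ∀ x ∈ domainSelf m, HasDerivAt (fun x : ℂ => (x / m).sqrt)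
      (1 / m / (2 * (x / m).sqrt)) x := fun x hx =>
    HasDerivAt.csqrt ((hasDerivAt_id' x).div_const m) hx.1
  have d2 : ∀ x ∈ domainSelf m, HasDerivAt (fun x : ℂ => ((1 - x) / (1 - m)).sqrt)
      (-1 / (1 - m) / (2 * ((1 - x) / (1 - m)).sqrt)) x := fun x hx =>
    HasDerivAt.csqrt (((hasDerivAt_id' x).const_sub 1).div_const _) hx.2
  have h0 : ∀ x ∈ domainSelf m, (x / m).sqrt * ((1 - x) / (1 - m)).sqrt ≠ 0 := fun x hx =>
    mul_ne_zero (csqrt_ne_zero (slitPlane_ne_zero hx.1)) (csqrt_ne_zero (slitPlane_ne_zero hx.2))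
  obtain ⟨N', hN', hN⟩ := exists_hasDerivAt_radialMean (isOpen_domainSelf m)
    (starConvex_domainSelf hm hm1) 2
    (F := fun x => 1 / ((x / m).sqrt * ((1 - x) / (1 - m)).sqrt))
    (fun x hx => (((hasDerivAt_const x (1 : ℂ)).div ((d1 x hx).mul (d2 x hx))
      (h0 x hx)).differentiableAt).differentiableWithinAt) hz
  have ha := csqrt_ne_zero (slitPlane_ne_zero hz.1)
  have hb := csqrt_ne_zero (slitPlane_ne_zero hz.2)
  refine ⟨_, ((((hasDerivAt_id z).sub_const m).const_mul I).mul hN').div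
    (((d1 z hz).mul (d2 z hz)).const_mul (m * (1 - m)))
      (mul_ne_zero (mul_ne_zero hm hm1) (mul_ne_zero ha hb)), ?_⟩
  have ha2 := csqrt_sq (z / m)
  have hb2 := csqrt_sq ((1 - z) / (1 - m))
  simp only [chartSelf, Pi.mul_apply, id] at hN ⊢
  generalize radialMean 2 m _ z = N at *
  generalize (z / m).sqrt = a at *
  generalize ((1 - z) / (1 - m)).sqrt = b at *
  have hz1 : z = m * a ^ 2 := by rw [ha2]; field_simp
  have hz2 : 1 - z = (1 - m) * b ^ 2 := by rw [hb2]; field_simp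
  have hN2 : 1 = a * b * (2 * (z - m) * N' + 3 * N) := by
    rw [eq_div_iff (mul_ne_zero ha hb)] at hN
    push_cast at hN
    linear_combination -hN
  rw [show z * (1 - z) * (m - z) = m * a ^ 2 * ((1 - m) * b ^ 2) * (m - z) by rw [← hz2, ← hz1],
    show (1 - 2 * z) * (m - z) - z * (1 - z) = ((1 - m) * b ^ 2 - m * a ^ 2) * (m - z) -
      m * a ^ 2 * ((1 - m) * b ^ 2) by rw [← hz2, ← hz1]; ring]
  clear hN ha2 hb2 hz1 hz2
  field_simp
  linear_combination (m * a * b * (1 - m) * (z - m)) * hN2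

/-- The chart equation is linear, so the difference g of two charts satisfies 2qg' + q'g = 0, that
is, (q g²)' = 0. Squaring avoids any choice of sign for √q. -/
theorem IsChart.hasDerivAt_sub_sq {m z : ℂ} {f g : ℂ → ℂ} (hf : IsChart m f z)
    (hg : IsChart m g z) :
    HasDerivAt (fun z => 4 * (z * (1 - z) * (m - z)) * (f z - g z) ^ 2) 0 z := by
  obtain ⟨f', hf, ef⟩ := hf
  obtain ⟨g', hg, eg⟩ := hg
  have hi := hasDerivAt_id' z
  have h := ((((hi.mul (hi.const_sub 1)).mul (hi.const_sub m)).const_mul 4)).mul ((hf.sub hg).pow 2)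
  refine h.congr_deriv ?_
  simp
  linear_combination 4 * (f z - g z) * (ef - eg)

/-! ### The constant between two charts -/

/-- The half-plane bounded by the line through `m` orthogonal to `m`, slit along the ray from `0`
away from `m`. -/
def overlap (m : ℂ) : Set ℂ := {z | (z / m).re < 1 ∧ z / m ∈ slitPlane}

theorem isOpen_overlap (m : ℂ) : IsOpen (overlap m) :=
  (isOpen_lt (f := fun z : ℂ => (z / m).re) (g := fun _ => 1) (by fun_prop) (by fun_prop)).inter
    (isOpen_slitPlane.preimage (f := fun z : ℂ => z / m) (by fun_prop))

theorem isPreconnected_overlap {m : ℂ} (hm : m ≠ 0) : IsPreconnected (overlap m) := by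
  have hmem : m / 2 ∈ overlap m := by
    have : m / 2 / m = ((1 / 2 : ℝ) : ℂ) := by push_cast; field_simp
    refine ⟨?_, ?_⟩
    · rw [this, ofReal_re]; norm_num
    · rw [this, ofReal_mem_slitPlane]; norm_num
  have hstar : StarConvex ℝ (m / 2) (overlap m) := by
    rintro z ⟨h1, h2⟩ a b ha hb hab
    have e : (a • (m / 2) + b • z) / m = (a / 2 : ℝ) + (b : ℝ) * (z / m) := by
      simp only [real_smul]; push_cast; field_simp
    have hre : ((a • (m / 2) + b • z) / m).re = a / 2 + b * (z / m).re := by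
      rw [e]; simp
    have him : ((a • (m / 2) + b • z) / m).im = b * (z / m).im := by
      rw [e]; simp
    refine ⟨?_, ?_⟩
    · rw [hre]
      rcases hb.eq_or_lt with rfl | hb
      · nlinarith
      · nlinarith
    · rcases hb.eq_or_lt with h | hb
      · left; rw [hre, ← h]; rw [← h] at hab; linarith
      · rcases h2 with h2 | h2
        · left; rw [hre]; have := mul_pos hb h2; linarith
        · right; rw [him]; exact mul_ne_zero hb.ne' h2
  exact (hstar.isPathConnected hmem).isConnected.isPreconnected

theorem not_mem_slitPlane {z : ℂ} (h : z ∉ slitPlane) : z = -((-z.re : ℝ) : ℂ) ∧ 0 ≤ -z.re := by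
  rw [mem_slitPlane_iff, not_or, not_lt, not_not] at h
  refine ⟨Complex.ext (by simp) (by simp [h.2]), by linarith [h.1]⟩

/-- The disc with diameter `[0, 1]`, in terms of the inverse. -/
theorem one_lt_re_inv {m : ℂ} (hm : m ≠ 0) (h : normSq m < m.re) : 1 < (1 / m).re := by
  rw [one_div, inv_re, lt_div_iff₀ (normSq_pos.2 hm)]; simpa using h

/-- Since Re(1/m) > 1 inside the disc, the ray from 1 to infinity lies entirely beyond the line
through m orthogonal to m. -/
theorem halfPlane_subset_domainZero {m z : ℂ} (hm : m ≠ 0) (h : normSq m < m.re)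
    (hz : (z / m).re < 1) : z ∈ domainZero m := by
  have hR := one_lt_re_inv hm h
  refine ⟨Or.inl (by simpa using hz), ?_⟩
  by_contra hs
  obtain ⟨e, h0⟩ := not_mem_slitPlane hs
  generalize -(1 - z).re = t at e h0
  have : z / m = ((1 + t : ℝ) : ℂ) * (1 / m) := by
    push_cast; rw [show z = 1 + t by linear_combination -e]; ring
  rw [this, re_ofReal_mul] at hz
  nlinarith

theorem overlap_subset_domainZero {m : ℂ} (hm : m ≠ 0) (h : normSq m < m.re) :
    overlap m ⊆ domainZero m := fun _ hz => halfPlane_subset_domainZero hm h hz.1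

/-- A point 1 + t(1 - m) of the cut at 1 has Re(z/m) = (1 + t) Re(1/m) - t > 1, so the cut misses
the half-plane. -/
theorem overlap_subset_domainSelf {m : ℂ} (hm : m ≠ 0) (hm1 : 1 - m ≠ 0)
    (h : normSq m < m.re) : overlap m ⊆ domainSelf m := by
  rintro z ⟨h1, h2⟩
  have hR := one_lt_re_inv hm h
  refine ⟨h2, ?_⟩
  by_contra hs
  obtain ⟨e, h0⟩ := not_mem_slitPlane hs
  generalize -((1 - z) / (1 - m)).re = t at e h0
  rw [div_eq_iff hm1] at e
  have : z / m = ((1 + t : ℝ) : ℂ) * (1 / m) - (t : ℝ) := by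
    rw [show z = 1 + t * (1 - m) by linear_combination -e]
    push_cast; field_simp; ring
  rw [this, sub_re, re_ofReal_mul, ofReal_re] at h1
  nlinarith

/-- The integral of `chartZero` along the segment from `0` to `m`, cut off at `x m`. -/
def partialAction (m : ℂ) (x : ℝ) : ℂ :=
  ∫ r in (0 : ℝ)..1, (√(1 - r ^ 2 * x) : ℝ) / (1 - (r : ℂ) ^ 2 * (x * m)).sqrt

theorem one_sub_mul_mem_slitPlane {m : ℂ} (hm : m.im ≠ 0) (s : ℝ) :
    1 - (s : ℂ) * m ∈ slitPlane := by
  rcases eq_or_ne s 0 with rfl | hs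
  · simp
  · right; simpa using ⟨hs, hm⟩

theorem continuous_partialAction {m : ℂ} (hm : m.im ≠ 0) : Continuous (partialAction m) := by
  refine intervalIntegral.continuous_parametric_intervalIntegral_of_continuous' ?_ 0 1
  have hs : ∀ p : ℝ × ℝ, (1 - (p.2 : ℂ) ^ 2 * (p.1 * m)) ∈ slitPlane := fun p => by
    have := one_sub_mul_mem_slitPlane hm (p.2 ^ 2 * p.1)
    push_cast at this
    rwa [mul_assoc] at this
  refine Continuous.div (by fun_prop) ?_ fun p => csqrt_ne_zero (slitPlane_ne_zero (hs p))
  rw [continuous_iff_continuousAt]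
  intro p
  exact ContinuousAt.comp (g := Complex.sqrt)
    (f := fun p : ℝ × ℝ => 1 - (p.2 : ℂ) ^ 2 * (p.1 * m)) (continuousAt_csqrt (hs p))
    (by fun_prop)

theorem radialMean_eq_partialAction {m : ℂ} (hm : m ≠ 0) {x : ℝ} (hx : x ≤ 1) :
    radialMean 0 0 (fun y => (1 - y / m).sqrt / (1 - y).sqrt) (x * m) = partialAction m x := by
  refine integral_congr fun r hr => ?_
  rw [uIcc_of_le zero_le_one] at hr
  have h1 : r ^ 2 ≤ 1 := pow_le_one₀ hr.1 hr.2
  have h2 : 0 ≤ 1 - r ^ 2 * x := by nlinarith [sq_nonneg r]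
  simp only [pow_zero, one_mul, zero_add, sub_zero]
  rw [← csqrt_ofReal h2, ← mul_assoc, mul_div_assoc, div_self hm]
  push_cast
  ring_nf

theorem action_eq_partialAction {m : ℂ} (hm : m.im ≠ 0) :
    action m = 8 * m * partialAction m 1 := by
  have hs : ∀ r : ℝ, (1 - (r : ℂ) ^ 2 * m) ∈ slitPlane := fun r => by
    have := one_sub_mul_mem_slitPlane hm (r ^ 2)
    push_cast at this
    exact this
  have hg : Continuous fun r : ℝ => ((√(1 - r ^ 2) : ℝ) : ℂ) / (1 - (r : ℂ) ^ 2 * m).sqrt := by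
    refine Continuous.div (by fun_prop) ?_ fun p => csqrt_ne_zero (slitPlane_ne_zero (hs p))
    rw [continuous_iff_continuousAt]
    intro p
    exact ContinuousAt.comp (g := Complex.sqrt)
      (f := fun p : ℝ => 1 - (p : ℂ) ^ 2 * m) (continuousAt_csqrt (hs p)) (by fun_prop)
  have h := integral_deriv_smul_comp (a := 0) (b := Real.pi / 2) (f := Real.sin)
    (f' := Real.cos) (fun x _ => Real.hasDerivAt_sin x) Real.continuous_cos.continuousOn hg
  rw [Real.sin_zero, Real.sin_pi_div_two] at h
  rw [partialAction]
  simp only [mul_one, ofReal_one, one_mul]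
  rw [← h, ← intervalIntegral.integral_const_mul, action]
  refine integral_congr fun t ht => ?_
  rw [uIcc_of_le (by positivity)] at ht
  have hc : 0 ≤ Real.cos t := Real.cos_nonneg_of_mem_Icc ⟨by linarith [ht.1, Real.pi_pos], ht.2⟩
  have : √(1 - Real.sin t ^ 2) = Real.cos t := by
    rw [← Real.cos_sq', Real.sqrt_sq hc]
  simp only [Function.comp, real_smul, this]
  ring_nf

/-- The two charts differ by the period of the segment from `0` to `m`. -/
theorem chartZero_sub_chartSelf {m : ℂ} (hm : m.im ≠ 0) (h : normSq m < m.re) {z : ℂ}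
    (hz : z ∈ overlap m) :
    4 * (z * (1 - z) * (m - z)) * (chartZero m z - chartSelf m z) ^ 2 = -(action m) ^ 2 / 16 := by
  have hm0 := ne_zero_of_im_ne_zero hm
  have hm1 := one_sub_ne_zero_of_im_ne_zero hm
  set E : ℂ → ℂ := fun z => 4 * (z * (1 - z) * (m - z)) * (chartZero m z - chartSelf m z) ^ 2
  have hE : ∀ w ∈ overlap m, HasDerivAt E 0 w := fun w hw =>
    (isChart_chartZero hm0 (overlap_subset_domainZero hm0 h hw)).hasDerivAt_sub_sq
      (isChart_chartSelf hm0 hm1 (overlap_subset_domainSelf hm0 hm1 h hw))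
  have hconst : ∀ w ∈ overlap m, E w = E z := fun w hw =>
    (isOpen_overlap m).is_const_of_deriv_eq_zero (isPreconnected_overlap hm0)
      (fun w hw => (hE w hw).differentiableAt.differentiableWithinAt)
      (fun w hw => (hE w hw).deriv) hw hz
  -- The constant is evaluated by letting z = xm tend to m. `chartZero` is singular there, so `G` is
  -- the expanded square with the factor √(1 - x) already cancelled; it is continuous at x = 1,
  -- where only the first term survives.
  let G : ℝ → ℂ := fun x => -4 * x * m ^ 2 * partialAction m x ^ 2 -
    8 * I * x * m ^ 2 * (√(1 - x) : ℝ) * (1 - (x : ℂ) * m).sqrt * partialAction m x *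
      chartSelf m (x * m) +
    4 * (x * m * (1 - x * m) * (m - x * m)) * chartSelf m (x * m) ^ 2
  have hG : ContinuousAt G 1 := by
    have c1 := (continuous_partialAction hm).continuousAt (x := 1)
    have c2 : ContinuousAt (fun x : ℝ => (1 - (x : ℂ) * m).sqrt) 1 :=
      ContinuousAt.comp (g := Complex.sqrt) (f := fun x : ℝ => 1 - (x : ℂ) * m)
        (continuousAt_csqrt (one_sub_mul_mem_slitPlane hm 1)) (by fun_prop)
    have c3 : ContinuousAt (fun x : ℝ => chartSelf m (x * m)) 1 := by
      have hmem : ((1 : ℝ) : ℂ) * m ∈ domainSelf m := by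
        rw [ofReal_one, one_mul]
        exact ⟨by rw [div_self hm0]; exact one_mem_slitPlane,
          by rw [div_self hm1]; exact one_mem_slitPlane⟩
      obtain ⟨f', hf', -⟩ := isChart_chartSelf hm0 hm1 hmem
      exact ContinuousAt.comp (g := chartSelf m) (f := fun x : ℝ => (x : ℂ) * m)
        hf'.continuousAt (by fun_prop)
    fun_prop
  have hG1 : G 1 = -(action m) ^ 2 / 16 := by
    simp only [G, ofReal_one, one_mul, chartSelf_self, action_eq_partialAction hm]
    ring
  have hGE : ∀ x ∈ Ioo (0 : ℝ) 1, G x = E z := by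
    intro x hx
    have hov : (x : ℂ) * m ∈ overlap m := by
      rw [overlap, mem_ofPred_eq, mul_div_assoc, div_self hm0, mul_one]
      exact ⟨by simpa using hx.2, by simpa using hx.1⟩
    rw [← hconst _ hov]
    have hd := overlap_subset_domainZero hm0 h hov
    have ha := csqrt_ne_zero (slitPlane_ne_zero hd.1)
    have hb := csqrt_ne_zero (slitPlane_ne_zero hd.2)
    have ha2 := csqrt_sq (1 - x * m / m)
    have hb2 := csqrt_sq (1 - x * m)
    have hx1 : (1 : ℂ) - x * m / m = ((1 - x : ℝ) : ℂ) := by push_cast; field_simp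
    rw [hx1] at ha ha2
    rw [csqrt_ofReal (by linarith [hx.2])] at ha ha2
    simp only [E, G]
    rw [chartZero, radialMean_eq_partialAction hm0 hx.2.le, hx1,
      csqrt_ofReal (by linarith [hx.2])]
    generalize (√(1 - x) : ℝ) = a at *
    generalize (1 - (x : ℂ) * m).sqrt = b at *
    generalize chartSelf m (x * m) = f
    generalize partialAction m x = N
    have e1 : m - x * m = m * a ^ 2 := by rw [ha2]; push_cast; ring
    rw [e1, ← hb2]
    field_simp
    ring_nf
    rw [I_sq]
    ring
  have hlim : Tendsto G (𝓝[<] 1) (𝓝 (E z)) := by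
    refine tendsto_const_nhds.congr' ?_
    filter_upwards [Ioo_mem_nhdsLT (zero_lt_one' ℝ)] with x hx using (hGE x hx).symm
  rw [← hG1]
  exact tendsto_nhds_unique hlim (hG.tendsto.mono_left nhdsWithin_le_nhds)

/-! ### From the curve to the coordinates x and y -/

/-- The coordinate `s²`, where `2 i s = l - 1 / l`. -/
def xCoord (l : ℂ) : ℂ := (2 - l ^ 2 - l⁻¹ ^ 2) / 4

/-- The coordinate `y` with `y² = 4 x (1 - x) (m - x)`. -/
def yCoord (l w : ℂ) : ℂ := -I / 4 * (l ^ 2 - l⁻¹ ^ 2) * (w * l⁻¹)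

theorem curve_iff {m l w : ℂ} (hl : l ≠ 0) :
    w ^ 2 = l ^ 4 - (2 - 4 * m) * l ^ 2 + 1 ↔ (w * l⁻¹) ^ 2 = 4 * (m - xCoord l) := by
  rw [xCoord, mul_pow, inv_pow, ← div_eq_mul_inv, div_eq_iff (pow_ne_zero 2 hl)]
  constructor
  · intro h; rw [h]; field_simp; ring
  · intro h; rw [h]; field_simp; ring

theorem xCoord_mul_one_sub (l : ℂ) (hl : l ≠ 0) :
    xCoord l * (1 - xCoord l) = -(l ^ 2 - l⁻¹ ^ 2) ^ 2 / 16 := by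
  rw [xCoord]; field_simp; ring

theorem yCoord_sq {m l w : ℂ} (hl : l ≠ 0) (h : (w * l⁻¹) ^ 2 = 4 * (m - xCoord l)) :
    yCoord l w ^ 2 = 4 * (xCoord l * (1 - xCoord l) * (m - xCoord l)) := by
  rw [xCoord_mul_one_sub l hl, yCoord, mul_pow, h, mul_pow, div_pow, neg_sq, I_sq]
  ring

/-- The product y f(x) is a primitive of the differential along a path on the curve. It is
polynomial in λ, 1/λ and w apart from f(x), so the points over x = 0 and x = 1 need no special
treatment; only w = 0 does. -/
theorem hasDerivWithinAt_yCoord_mul_chart {m : ℂ} (hm : m ≠ 0) (hm1 : 1 - m ≠ 0) {l w : ℝ → ℂ}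
    {l' w' : ℂ} {S : Set ℝ} {t : ℝ} (hS : UniqueDiffWithinAt ℝ S t) (ht : t ∈ S)
    (hl : HasDerivWithinAt l l' S t) (hw : HasDerivWithinAt w w' S t) (hl0 : ∀ r ∈ S, l r ≠ 0)
    (hc : ∀ r ∈ S, (w r * (l r)⁻¹) ^ 2 = 4 * (m - xCoord (l r))) {f : ℂ → ℂ}
    (hf : IsChart m f (xCoord (l t))) (hfm : xCoord (l t) = m → f m = 0) :
    HasDerivWithinAt (fun r => yCoord (l r) (w r) * f (xCoord (l r)))
      (w t / l t ^ 2 * l') S t := by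
  obtain ⟨f', hf, e⟩ := hf
  have h0 := hl0 t ht
  have hu : HasDerivWithinAt (fun r => (l r)⁻¹) (-l' / l t ^ 2) S t := hl.fun_inv h0
  have hX : HasDerivWithinAt (fun r => xCoord (l r)) (-(l t - (l t)⁻¹ ^ 3) * l' / 2) S t := by
    refine (((hl.pow 2).const_sub 2).sub (hu.pow 2)).div_const 4 |>.congr_deriv ?_
    push_cast; simp only [pow_one]; field_simp; ring
  have hv := hw.mul hu
  have hrel : 2 * (w t * (l t)⁻¹) * (w' * (l t)⁻¹ + w t * (-l' / l t ^ 2)) =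
      2 * (l t - (l t)⁻¹ ^ 3) * l' := by
    have h1 := (hv.pow 2).congr (f₁ := fun r => 4 * (m - xCoord (l r)))
      (fun r hr => (hc r hr).symm) (hc t ht).symm
    have h2 := (hX.const_sub m).const_mul 4
    have := hS.eq_deriv _ h1 h2
    simp only [Nat.add_one_sub_one, pow_one, Pi.mul_apply] at this
    push_cast at this
    linear_combination this
  have hfX := hf.comp_hasDerivWithinAt t hX
  refine ((((hl.pow 2).sub (hu.pow 2)).const_mul (-I / 4)).mul hv).mul hfX |>.congr_deriv ?_
  have hct := hc t ht
  have hX1 := xCoord_mul_one_sub (l t) h0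
  have hXd : 1 - 2 * xCoord (l t) = ((l t) ^ 2 + (l t)⁻¹ ^ 2) / 2 := by rw [xCoord]; ring
  simp only [Function.comp, Pi.mul_apply, Pi.pow_apply, Pi.sub_apply, Nat.add_one_sub_one,
    pow_one, Nat.cast_ofNat]
  -- At w = 0 one has x = m, and differentiating the curve equation forces λ' = 0 because m ≠ 0, 1.
  -- Both sides then vanish, the left one thanks to f(m) = 0.
  rcases eq_or_ne (w t) 0 with hw0 | hw0
  · have hXm : xCoord (l t) = m := by
      rw [hw0] at hct
      linear_combination (1 / 4 : ℂ) * hct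
    have hfm := hfm hXm
    have hl'0 : l' = 0 := by
      have hne : (l t) ^ 2 - (l t)⁻¹ ^ 2 ≠ 0 := by
        intro hz
        rw [hz, hXm] at hX1
        exact mul_ne_zero hm hm1 (by simpa using hX1)
      rw [hw0] at hrel
      have : l t - (l t)⁻¹ ^ 3 = ((l t) ^ 2 - (l t)⁻¹ ^ 2) * (l t)⁻¹ := by field_simp
      rw [this] at hrel
      have h3 := inv_ne_zero h0
      simp_all
    rw [hw0, hXm, hfm, hl'0]
    simp
  · have hmX : m - xCoord (l t) = (w t * (l t)⁻¹) ^ 2 / 4 := by rw [hct]; ring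
    rw [hmX, hX1, hXd] at e
    generalize f (xCoord (l t)) = F at *
    generalize l t = x at *
    generalize w t = z at *
    clear hf hfX hX hv hu hl hw hfm hXd hX1 hmX hct
    have hI := I_sq
    field_simp at e hrel ⊢
    refine mul_left_cancel₀ hw0 ?_
    linear_combination (-I * l' / 4) * e - 2 * I * x ^ 2 * F * (x ^ 4 - 1) * hrel -
      8 * x ^ 4 * z ^ 2 * l' * hI

/-! ### Cycles and primitives along them -/

namespace Cycle

variable {A : ℂ} (c : Cycle A)

def lam (t : ℝ) : ℂ := (c.path.extend t).1

def wCoord (t : ℝ) : ℂ := (c.path.extend t).2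

theorem extend_mem (t : ℝ) : c.path.extend t ∈ curve A :=
  c.mem_curve (projIcc 0 1 zero_le_one t)

theorem lam_ne_zero (t : ℝ) : c.lam t ≠ 0 := (c.extend_mem t).2

theorem hasDerivWithinAt_extend {t : ℝ} (ht : t ∈ Icc (0 : ℝ) 1) :
    HasDerivWithinAt c.path.extend (derivWithin c.path.extend (Icc 0 1) t) (Icc 0 1) t :=
  ((c.contDiffOn.differentiableOn one_ne_zero) t ht).hasDerivWithinAt

theorem hasDerivWithinAt_lam {t : ℝ} (ht : t ∈ Icc (0 : ℝ) 1) :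
    HasDerivWithinAt c.lam (derivWithin c.path.extend (Icc 0 1) t).1 (Icc 0 1) t :=
  (ContinuousLinearMap.fst ℝ ℂ ℂ).hasFDerivAt.comp_hasDerivWithinAt t (c.hasDerivWithinAt_extend ht)

theorem hasDerivWithinAt_wCoord {t : ℝ} (ht : t ∈ Icc (0 : ℝ) 1) :
    HasDerivWithinAt c.wCoord (derivWithin c.path.extend (Icc 0 1) t).2 (Icc 0 1) t :=
  (ContinuousLinearMap.snd ℝ ℂ ℂ).hasFDerivAt.comp_hasDerivWithinAt t (c.hasDerivWithinAt_extend ht)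

theorem curveIntegralFun_form (t : ℝ) :
    curveIntegralFun form c.path t =
      c.wCoord t / c.lam t ^ 2 * (derivWithin c.path.extend (Icc 0 1) t).1 := by
  rw [curveIntegralFun_def]
  simp [form, lam, wCoord]

theorem curveIntegrable : CurveIntegrable form c.path := by
  refine ContinuousOn.curveIntegrable_of_contDiffOn (s := curve A) ?_ c.contDiffOn c.mem_curve
  unfold form
  refine ContinuousOn.smul (ContinuousOn.div continuousOn_snd (continuousOn_fst.pow 2) ?_)
    continuousOn_const
  exact fun p hp => pow_ne_zero 2 hp.2

theorem integral_eq : c.integral = ∫ t in (0 : ℝ)..1,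
    c.wCoord t / c.lam t ^ 2 * (derivWithin c.path.extend (Icc 0 1) t).1 := by
  rw [integral, curveIntegral_def]
  exact integral_congr fun t _ => c.curveIntegralFun_form t

/-- The imaginary part of a multiple of the integral vanishes if the corresponding real 1-form has
a primitive along the loop. -/
theorem im_mul_integral_eq_zero (E : ℂ) {h : ℝ → ℝ} (h01 : h 0 = h 1)
    (hd : ∀ t ∈ Icc (0 : ℝ) 1, HasDerivWithinAt h
      (E * (c.wCoord t / c.lam t ^ 2 * (derivWithin c.path.extend (Icc 0 1) t).1)).im
      (Icc 0 1) t) : (E * c.integral).im = 0 := by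
  have hint := c.curveIntegrable
  rw [CurveIntegrable, funext c.curveIntegralFun_form] at hint
  have hint' := hint.const_mul E
  rw [integral_eq, ← intervalIntegral.integral_const_mul]
  have e := imCLM.intervalIntegral_comp_comm hint'
  simp only [imCLM_apply] at e
  rw [← e, integral_eq_sub_of_hasDeriv_right_of_le zero_le_one
    (fun t ht => (hd t ht).continuousWithinAt), h01, sub_self]
  · intro t ht
    exact ((hd t (Ioo_subset_Icc_self ht)).hasDerivAt (Icc_mem_nhds ht.1 ht.2)).hasDerivWithinAt
  · exact ⟨imCLM.integrable_comp hint'.1, imCLM.integrable_comp hint'.2⟩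

end Cycle

/-! ### Gluing the charts to a single-valued height -/

theorem IsChart.reflect {m z : ℂ} {f : ℂ → ℂ} (h : IsChart (1 - m) f (1 - z)) :
    IsChart m (fun z => -f (1 - z)) z := by
  obtain ⟨f', hf, e⟩ := h
  refine ⟨f', ?_, ?_⟩
  · have := (hf.comp z ((hasDerivAt_id' z).const_sub 1)).neg
    exact this.congr_deriv (by simp)
  · linear_combination -e

theorem chartSelf_reflect (m z : ℂ) : -chartSelf (1 - m) (1 - z) = chartSelf m z := by
  have : radialMean 2 (1 - m)
      (fun x => 1 / ((x / (1 - m)).sqrt * ((1 - x) / (1 - (1 - m))).sqrt)) (1 - z) =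
      radialMean 2 m (fun x => 1 / ((x / m).sqrt * ((1 - x) / (1 - m)).sqrt)) z := by
    refine integral_congr fun r _ => ?_
    simp only [sub_sub_cancel]
    rw [mul_comm (Complex.sqrt _)]
    ring_nf
  rw [chartSelf, chartSelf, this]
  simp only [sub_sub_cancel]
  rw [mul_comm (Complex.sqrt _), mul_comm (1 - m)]
  ring

theorem im_eq_zero_of_sq {z : ℂ} {r : ℝ} (h : z ^ 2 = (r : ℂ) ^ 2) : z.im = 0 := by
  rcases sq_eq_sq_iff_eq_or_eq_neg.1 h with rfl | rfl <;> simp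

/-- The primitive of the real 1-form, as a function of the point `z` and the root `y`. -/
def height (E m z y : ℂ) : ℝ :=
  open Classical in
  (E * (y * if z ∈ domainSelf m then chartSelf m z
    else if z / m ∈ slitPlane then -chartZero (1 - m) (1 - z) else chartZero m z)).im

theorem normSq_one_sub_lt {m : ℂ} (h : normSq m < m.re) : normSq (1 - m) < (1 - m).re := by
  simp only [normSq_apply, sub_re, one_re, sub_im, one_im] at h ⊢
  nlinarith

/-- The two primitives differ by ± i `action m` / 4. After multiplication by E this is real exactly
under the first period equation. -/
theorem im_chartZero_eq {E m : ℂ} (hm : m.im ≠ 0) (hdisc : normSq m < m.re)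
    (h0 : (E * action m).re = 0) {z y : ℂ} (hz : z ∈ overlap m)
    (hy : y ^ 2 = 4 * (z * (1 - z) * (m - z))) :
    (E * (y * chartZero m z)).im = (E * (y * chartSelf m z)).im := by
  rw [← sub_eq_zero, ← sub_im, ← mul_sub, ← mul_sub]
  apply im_eq_zero_of_sq (r := (E * action m).im / 4)
  rw [mul_pow, mul_pow, hy, chartZero_sub_chartSelf hm hdisc hz]
  have : E * action m = I * ((E * action m).im : ℝ) := Complex.ext (by simp [h0]) (by simp)
  have h2 : (E * action m) ^ 2 = -((E * action m).im : ℂ) ^ 2 := by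
    conv_lhs => rw [this]
    rw [mul_pow, I_sq]; ring
  push_cast
  linear_combination (-1 / 16 : ℂ) * h2

/-- Under z ↦ 1 - z, m ↦ 1 - m the polynomial z(1-z)(m-z) changes sign, so y becomes iy. Replacing E
by iE as well turns the condition Re = 0 into Im = 0. -/
theorem im_chartOne_eq {E m : ℂ} (hm : m.im ≠ 0) (hdisc : normSq m < m.re)
    (h1 : (E * action (1 - m)).im = 0) {z y : ℂ} (hz : 1 - z ∈ overlap (1 - m))
    (hy : y ^ 2 = 4 * (z * (1 - z) * (m - z))) :
    (E * (y * -chartZero (1 - m) (1 - z))).im = (E * (y * chartSelf m z)).im := by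
  have := im_chartZero_eq (E := I * E) (m := 1 - m) (z := 1 - z) (y := I * y) (by simpa using hm)
    (normSq_one_sub_lt hdisc) (by rw [mul_assoc, I_mul_re, h1, neg_zero]) hz
    (by rw [mul_pow, hy, I_sq]; ring)
  rw [← chartSelf_reflect]
  convert this using 2
  · linear_combination (-(E * y * chartZero (1 - m) (1 - z))) * I_sq
  · linear_combination (-(E * y * chartSelf (1 - m) (1 - z))) * I_sq

/-- The two cuts are disjoint: if -tm = 1 + s(1 - m), imaginary parts give t = s, and real parts
then give t = -1, contrary to t ≥ 0. -/
theorem reflect_mem_slitPlane {m z : ℂ} (hm : m.im ≠ 0) (hz : z / m ∉ slitPlane) :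
    (1 - z) / (1 - m) ∈ slitPlane := by
  have hm0 := ne_zero_of_im_ne_zero hm
  have hm1 := one_sub_ne_zero_of_im_ne_zero hm
  by_contra hs
  obtain ⟨e1, h1⟩ := not_mem_slitPlane hz
  obtain ⟨e2, h2⟩ := not_mem_slitPlane hs
  generalize -(z / m).re = t at e1 h1
  generalize -((1 - z) / (1 - m)).re = s at e2 h2
  rw [div_eq_iff hm0] at e1
  rw [div_eq_iff hm1, e1] at e2
  have i := congrArg im e2
  have r := congrArg re e2
  simp at i r
  have : t = s := i.resolve_right hm
  subst this
  linarith

/-- Locally the height is given by a single chart. -/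
theorem exists_chart {E m : ℂ} (hm : m.im ≠ 0) (hdisc : normSq m < m.re)
    (h0 : (E * action m).re = 0) (h1 : (E * action (1 - m)).im = 0) (z : ℂ) :
    ∃ f : ℂ → ℂ, IsChart m f z ∧ (z = m → f m = 0) ∧ ∀ᶠ x in 𝓝 z, ∀ y : ℂ,
      y ^ 2 = 4 * (x * (1 - x) * (m - x)) → height E m x y = (E * (y * f x)).im := by
  classical
  have hm0 := ne_zero_of_im_ne_zero hm
  have hm1 := one_sub_ne_zero_of_im_ne_zero hm
  by_cases hz : z ∈ domainSelf m
  · refine ⟨chartSelf m, isChart_chartSelf hm0 hm1 hz, fun _ => chartSelf_self m, ?_⟩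
    filter_upwards [(isOpen_domainSelf m).mem_nhds hz] with x hx y _
    rw [height, if_pos hx]
  have hzm : z ≠ m := by
    rintro rfl
    exact hz ⟨by rw [div_self hm0]; exact one_mem_slitPlane,
      by rw [div_self hm1]; exact one_mem_slitPlane⟩
  by_cases hs : z / m ∈ slitPlane
  -- Here z lies on the cut from 1, where the reflected chart takes over; in the next case z lies on
  -- the cut from 0.
  · have hs1 : (1 - z) / (1 - m) ∉ slitPlane := fun h => hz ⟨hs, h⟩
    have hre : ((1 - z) / (1 - m)).re < 1 := by
      have := (not_mem_slitPlane hs1).2; linarith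
    have hd := halfPlane_subset_domainZero hm1 (normSq_one_sub_lt hdisc) hre
    refine ⟨fun z => -chartZero (1 - m) (1 - z), (isChart_chartZero hm1 hd).reflect,
      fun h => absurd h hzm, ?_⟩
    filter_upwards [(isOpen_lt (f := fun z : ℂ => ((1 - z) / (1 - m)).re) (g := fun _ => 1)
      (by fun_prop) (by fun_prop)).mem_nhds hre,
      (isOpen_slitPlane.preimage (f := fun z : ℂ => z / m) (by fun_prop)).mem_nhds hs]
      with x hx1 hx2 y hy
    by_cases hx : x ∈ domainSelf m
    · rw [height, if_pos hx, im_chartOne_eq hm hdisc h1 ⟨hx1, hx.2⟩ hy]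
    · rw [height, if_neg hx, if_pos (show x / m ∈ slitPlane from hx2)]
  · have hre : (z / m).re < 1 := by
      have := (not_mem_slitPlane hs).2; linarith
    have hd := halfPlane_subset_domainZero hm0 hdisc hre
    refine ⟨chartZero m, isChart_chartZero hm0 hd, fun h => absurd h hzm, ?_⟩
    filter_upwards [(isOpen_lt (f := fun z : ℂ => (z / m).re) (g := fun _ => 1)
      (by fun_prop) (by fun_prop)).mem_nhds hre,
      (isOpen_slitPlane.preimage (f := fun z : ℂ => (1 - z) / (1 - m)) (by fun_prop)).mem_nhds
        (reflect_mem_slitPlane hm hs)] with x hx1 hx2 y hy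
    by_cases hx : x ∈ domainSelf m
    · rw [height, if_pos hx, im_chartZero_eq hm hdisc h0 ⟨hx1, hx.1⟩ hy]
    · rw [height, if_neg hx, if_neg fun h => hx ⟨h, hx2⟩]

/-- The Boutroux equations follow from the two equations for the basic periods. -/
theorem solves_of_action {φ : ℝ} {m : ℂ} (hm : m.im ≠ 0) (hdisc : normSq m < m.re)
    (h0 : (exp (I * φ) * action m).re = 0) (h1 : (exp (I * φ) * action (1 - m)).im = 0) :
    Solves φ (2 - 4 * m) := by
  intro c
  have hm0 := ne_zero_of_im_ne_zero hm
  have hm1 := one_sub_ne_zero_of_im_ne_zero hm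
  have hc : ∀ r, (c.wCoord r * (c.lam r)⁻¹) ^ 2 = 4 * (m - xCoord (c.lam r)) := fun r =>
    (curve_iff (c.lam_ne_zero r)).1 (c.extend_mem r).1
  refine c.im_mul_integral_eq_zero _
    (h := fun t => height (exp (I * φ)) m (xCoord (c.lam t)) (yCoord (c.lam t) (c.wCoord t)))
    (by simp [Cycle.lam, Cycle.wCoord]) fun t ht => ?_
  obtain ⟨f, hf, hfm, hev⟩ := exists_chart hm hdisc h0 h1 (xCoord (c.lam t))
  have hd := hasDerivWithinAt_yCoord_mul_chart hm0 hm1 (uniqueDiffOn_Icc_zero_one t ht) ht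
    (c.hasDerivWithinAt_lam ht) (c.hasDerivWithinAt_wCoord ht) (fun r _ => c.lam_ne_zero r)
    (fun r _ => hc r) hf hfm
  have hd' := imCLM.hasFDerivAt.comp_hasDerivWithinAt t (hd.const_mul (exp (I * φ)))
  have hX : ContinuousWithinAt (fun t => xCoord (c.lam t)) (Icc 0 1) t := by
    have := (c.hasDerivWithinAt_lam ht).continuousWithinAt
    unfold xCoord
    refine ContinuousWithinAt.div_const ((continuousWithinAt_const.sub (this.pow 2)).sub
      ((this.inv₀ (c.lam_ne_zero t)).pow 2)) 4
  refine hd'.congr_of_eventuallyEq ?_ ?_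
  · filter_upwards [hX.eventually hev] with r hr
    exact hr _ (yCoord_sq (c.lam_ne_zero r) (hc r))
  · exact hev.self_of_nhds _ (yCoord_sq (c.lam_ne_zero t) (hc t))

/-! ### The nodal curve A = 2 -/

/-- On the nodal curve `A = 2` the real 1-form has the primitive `Im (± (l + 1 / l))`. -/
theorem solves_zero_two : Solves 0 2 := by
  intro c
  -- The sign of the sheet. At a node division by zero gives 0, which is harmless because Im(λ +
  -- 1/λ) = 0 there.
  set k : ℝ → ℂ := fun t => c.wCoord t / (c.lam t ^ 2 - 1)
  have hw : ∀ t, c.wCoord t ^ 2 = (c.lam t ^ 2 - 1) ^ 2 := fun t => by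
    have h : c.wCoord t ^ 2 = c.lam t ^ 4 - 2 * c.lam t ^ 2 + 1 := (c.extend_mem t).1
    rw [h]; ring
  have hk : ∀ t, c.lam t ^ 2 - 1 ≠ 0 → k t ^ 2 = 1 := fun t ht => by
    simp only [k]; rw [div_pow, hw, div_self (pow_ne_zero 2 ht)]
  refine c.im_mul_integral_eq_zero _ (h := fun t => (k t * (c.lam t + (c.lam t)⁻¹)).im)
    (by simp [k, Cycle.lam, Cycle.wCoord]) fun t ht => ?_
  have hl := c.hasDerivWithinAt_lam ht
  have hl0 := c.lam_ne_zero t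
  have hJ := hl.add (hl.fun_inv hl0)
  simp only [ofReal_zero, mul_zero, exp_zero, one_mul]
  by_cases hne : c.lam t ^ 2 - 1 = 0
  · have hw0 : c.wCoord t = 0 := by
      have := hw t
      rw [hne] at this
      simpa using this
    have hr := imCLM.hasFDerivAt.comp_hasDerivWithinAt t hJ
    have hl2 : c.lam t ^ 2 = 1 := by linear_combination hne
    have hinv : (c.lam t)⁻¹ = c.lam t := inv_eq_of_mul_eq_one_left (by rw [← sq, hl2])
    have hre : c.lam t = 1 ∨ c.lam t = -1 := mul_self_eq_one_iff.1 (by rw [← sq, hl2])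
    have him : (c.lam t).im = 0 := by rcases hre with h | h <;> rw [h] <;> simp
    rw [hw0, zero_div, zero_mul, zero_im, hasDerivWithinAt_iff_isLittleO]
    rw [hl2, div_one, add_neg_cancel, map_zero, hasDerivWithinAt_iff_isLittleO] at hr
    -- Near a node the sign may jump arbitrarily, but |Im(kJ)| ≤ |Im J| for J = λ + 1/λ, and Im J
    -- vanishes to first order.
    refine Asymptotics.IsBigO.trans_isLittleO (Asymptotics.IsBigO.of_bound 1 ?_) hr
    refine Eventually.of_forall fun r => ?_
    have hk0 : k t = 0 := by simp [k, hne]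
    simp only [hk0, zero_mul, zero_im, smul_zero, sub_zero, Function.comp, imCLM_apply,
      Pi.add_apply, hinv, add_im, him, add_zero, one_mul]
    by_cases hr0 : c.lam r ^ 2 - 1 = 0
    · simp [k, hr0]
    · rcases mul_self_eq_one_iff.1 ((sq (k r)).symm.trans (hk r hr0)) with h | h <;> rw [h] <;> simp
      rw [← abs_neg]
      apply le_of_eq
      congr 1
      ring
  · obtain ⟨k', hd⟩ : ∃ k', HasDerivWithinAt k k' (Icc 0 1) t :=
      ⟨_, (c.hasDerivWithinAt_wCoord ht).div ((hl.pow 2).sub_const 1) hne⟩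
    have hev : ∀ᶠ r in 𝓝[Icc 0 1] t, c.lam r ^ 2 - 1 ≠ 0 :=
      ((hl.continuousWithinAt.pow 2).sub continuousWithinAt_const).eventually_ne hne
    have hk' : k' = 0 := by
      have h1 := (hd.pow 2).congr_of_eventuallyEq (f₁ := fun _ => (1 : ℂ))
        (hev.mono fun r hr => (hk r hr).symm) (hk t hne).symm
      have h2 := (uniqueDiffOn_Icc_zero_one t ht).eq_deriv _ h1 (hasDerivWithinAt_const t _ _)
      have : k t ≠ 0 := fun h => by have := hk t hne; rw [h] at this; simp at this
      simpa [this] using h2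
    have := imCLM.hasFDerivAt.comp_hasDerivWithinAt t (hd.mul hJ)
    refine this.congr_deriv ?_
    rw [hk', imCLM_apply, zero_mul, zero_add]
    congr 1
    simp only [k]
    field_simp
    ring

/-! ### Constructing cycles and the symmetries of the equations -/

namespace Cycle

/-- The cycle of a closed loop given by its coordinates. -/
def ofLoop {A : ℂ} (l w : ℝ → ℂ) (hl : ContDiff ℝ 1 l) (hw : ContDiff ℝ 1 w)
    (hmem : ∀ t, (l t, w t) ∈ curve A) (hl1 : l 1 = l 0) (hw1 : w 1 = w 0) : Cycle A where
  base := (l 0, w 0)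
  path :=
    { toFun := fun t => (l t, w t)
      continuous_toFun := by
        have := hl.continuous
        have := hw.continuous
        fun_prop
      source' := by simp
      target' := by simp [hl1, hw1] }
  mem_curve := fun t => hmem t
  contDiffOn := by
    refine (hl.prodMk hw).contDiffOn.congr fun t ht => ?_
    exact Path.extend_apply _ ht

theorem ofLoop_integral {A : ℂ} {l w : ℝ → ℂ} (hl : ContDiff ℝ 1 l) (hw : ContDiff ℝ 1 w)
    (hmem : ∀ t, (l t, w t) ∈ curve A) (hl1 : l 1 = l 0) (hw1 : w 1 = w 0) :
    (ofLoop l w hl hw hmem hl1 hw1).integral = ∫ t in (0 : ℝ)..1, w t / l t ^ 2 * deriv l t := by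
  rw [integral_eq]
  refine integral_congr fun t ht => ?_
  rw [uIcc_of_le zero_le_one] at ht
  have he : EqOn (ofLoop l w hl hw hmem hl1 hw1).path.extend (fun t => (l t, w t)) (Icc 0 1) :=
    fun t ht => Path.extend_apply _ ht
  have hd : HasDerivAt (fun t => (l t, w t)) (deriv l t, deriv w t) t :=
    ((hl.differentiable one_ne_zero) t).hasDerivAt.prodMk
      ((hw.differentiable one_ne_zero) t).hasDerivAt
  simp only [lam, wCoord]
  rw [derivWithin_congr he (he ht), he ht,
    hd.hasDerivWithinAt.derivWithin (uniqueDiffOn_Icc_zero_one t ht)]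

/-- The image of a cycle under a real linear map between two curves. -/
def map {A B : ℂ} (c : Cycle A) (L : ℂ × ℂ →L[ℝ] ℂ × ℂ) (hL : ∀ p ∈ curve A, L p ∈ curve B) :
    Cycle B where
  base := L c.base
  path := c.path.map L.continuous
  mem_curve := fun t => hL _ (c.mem_curve t)
  contDiffOn := L.contDiff.comp_contDiffOn c.contDiffOn

/-- Only real linearity is asked of the map and of `τ`, so that complex conjugation is covered along
with rotation. -/
theorem map_integral {A B : ℂ} (c : Cycle A) (L : ℂ × ℂ →L[ℝ] ℂ × ℂ)
    (hL : ∀ p ∈ curve A, L p ∈ curve B) (τ : ℂ →L[ℝ] ℂ)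
    (hτ : ∀ p v, form (L p) (L v) = τ (form p v)) : (c.map L hL).integral = τ c.integral := by
  have hint := c.curveIntegrable
  rw [CurveIntegrable] at hint
  rw [integral, integral, curveIntegral_def, curveIntegral_def,
    ← τ.intervalIntegral_comp_comm hint]
  refine integral_congr fun t ht => ?_
  rw [uIcc_of_le zero_le_one] at ht
  simp only [curveIntegralFun_def, ← hτ]
  have : HasDerivWithinAt (c.map L hL).path.extend
      (L (derivWithin c.path.extend (Icc 0 1) t)) (Icc 0 1) t :=
    L.hasFDerivAt.comp_hasDerivWithinAt t (c.hasDerivWithinAt_extend ht)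
  rw [this.derivWithin (uniqueDiffOn_Icc_zero_one t ht)]
  rfl

end Cycle

theorem Solves.add_pi {φ : ℝ} {A : ℂ} (h : Solves φ A) : Solves (φ + Real.pi) A := fun c => by
  have := h c
  push_cast
  rw [mul_add, exp_add, mul_comm I (Real.pi : ℂ), exp_pi_mul_I, mul_neg_one, neg_mul, neg_im, this,
    neg_zero]

/-- The map (λ, w) ↦ (iλ, w) carries the curve of -A to that of A and multiplies the differential by
-i. -/
theorem Solves.sub_pi_div_two {φ : ℝ} {A : ℂ} (h : Solves φ A) :
    Solves (φ - Real.pi / 2) (-A) := fun c => by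
  let L : ℂ × ℂ →L[ℝ] ℂ × ℂ :=
    (I • ContinuousLinearMap.fst ℝ ℂ ℂ).prod (ContinuousLinearMap.snd ℝ ℂ ℂ)
  have hLa : ∀ p, L p = (I * p.1, p.2) := fun p => rfl
  have hL : ∀ p ∈ curve (-A), L p ∈ curve A := fun p hp => by
    rw [hLa]
    refine ⟨?_, mul_ne_zero I_ne_zero hp.2⟩
    have := hp.1
    simp only
    rw [this, mul_pow, mul_pow, I_sq, I_pow_four]
    ring
  have e := c.map_integral L hL ((-I) • ContinuousLinearMap.id ℝ ℂ) fun p v => by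
    simp only [hLa, form, smul_apply, ContinuousLinearMap.coe_fst',
      ContinuousLinearMap.id_apply, smul_eq_mul]
    rw [mul_pow, I_sq]
    ring
  have := h (c.map L hL)
  rw [e] at this
  simp only [smul_apply, ContinuousLinearMap.id_apply, smul_eq_mul] at this
  rw [← mul_assoc] at this
  push_cast
  rw [mul_sub, exp_sub, mul_comm I ((Real.pi : ℂ) / 2), exp_pi_div_two_mul_I, div_I, ← mul_neg]
  exact this

theorem Solves.add_pi_div_two {φ : ℝ} {A : ℂ} (h : Solves φ A) :
    Solves (φ + Real.pi / 2) (-A) := by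
  have := h.add_pi.sub_pi_div_two
  rwa [show φ + Real.pi - Real.pi / 2 = φ + Real.pi / 2 by ring] at this

theorem Solves.conj {φ : ℝ} {A : ℂ} (h : Solves φ A) :
    Solves (-φ) (starRingEnd ℂ A) := fun c => by
  let K : ℂ →L[ℝ] ℂ := conjCLE
  let L : ℂ × ℂ →L[ℝ] ℂ × ℂ := K.prodMap K
  have hLa : ∀ p, L p = (starRingEnd ℂ p.1, starRingEnd ℂ p.2) := fun p => rfl
  have hL : ∀ p ∈ curve (starRingEnd ℂ A), L p ∈ curve A := fun p hp => by
    rw [hLa]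
    refine ⟨?_, (map_ne_zero _).2 hp.2⟩
    have := congrArg (starRingEnd ℂ) hp.1
    simpa using this
  have e := c.map_integral L hL K fun p v => by
    simp [hLa, form, K]
  have := h (c.map L hL)
  rw [e] at this
  have h2 : starRingEnd ℂ (exp (I * (-φ : ℝ)) * c.integral) = exp (I * φ) * K c.integral := by
    rw [map_mul, ← exp_conj]
    simp [K]
  rw [← h2, conj_im, neg_eq_zero] at this
  exact this

/-! ### The two basic period equations -/

theorem one_sub_mul_sq_mem_slitPlane {m : ℂ} (hm : 1 - m ∈ slitPlane) {s : ℝ} (hs : s ^ 2 ≤ 1) :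
    1 - m * (s : ℂ) ^ 2 ∈ slitPlane := by
  have := starConvex_one_slitPlane hm (sub_nonneg.2 hs) (sq_nonneg s) (sub_add_cancel _ _)
  convert this using 1
  simp only [real_smul]
  push_cast
  ring

theorem one_sub_mul_sin_sq_mem_slitPlane {m : ℂ} (hm : 1 - m ∈ slitPlane) (t : ℝ) :
    1 - m * (Real.sin t : ℂ) ^ 2 ∈ slitPlane :=
  one_sub_mul_sq_mem_slitPlane hm (Real.sin_sq_le_one t)

theorem continuous_csqrt_sin {m : ℂ} (hm : 1 - m ∈ slitPlane) :
    Continuous fun t : ℝ => (1 - m * (Real.sin t : ℂ) ^ 2).sqrt := by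
  rw [continuous_iff_continuousAt]
  exact fun t => ContinuousAt.comp (g := Complex.sqrt)
    (f := fun t : ℝ => 1 - m * (Real.sin t : ℂ) ^ 2)
    (continuousAt_csqrt (one_sub_mul_sin_sq_mem_slitPlane hm t)) (by fun_prop)

theorem csqrt_sin_ne_zero {m : ℂ} (hm : 1 - m ∈ slitPlane) (t : ℝ) :
    (1 - m * (Real.sin t : ℂ) ^ 2).sqrt ≠ 0 :=
  csqrt_ne_zero (slitPlane_ne_zero (one_sub_mul_sin_sq_mem_slitPlane hm t))

theorem action_conj {m : ℂ} (hm : 1 - m ∈ slitPlane) :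
    action (starRingEnd ℂ m) = starRingEnd ℂ (action m) := by
  rw [action, action, ← intervalIntegral_conj]
  refine integral_congr fun t _ => ?_
  simp only [map_div₀, map_mul, map_pow, conj_ofReal, map_ofNat]
  rw [← csqrt_conj (one_sub_mul_sin_sq_mem_slitPlane hm t), map_sub, map_one, map_mul, map_pow,
    conj_ofReal]

/-- A function that is invariant under `t ↦ π - t` and `t ↦ t + π` is determined by its values on
a quarter period. -/
theorem integral_eq_four_mul_quarter {G : ℝ → ℂ} (hG : Continuous G)
    (h1 : ∀ t, G (Real.pi - t) = G t) (h2 : ∀ t, G (t + Real.pi) = G t) :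
    ∫ t in (0 : ℝ)..(2 * Real.pi), G t = 4 * ∫ t in (0 : ℝ)..(Real.pi / 2), G t := by
  have a1 : ∫ t in (Real.pi / 2)..Real.pi, G t = ∫ t in (0 : ℝ)..(Real.pi / 2), G t := by
    have := integral_comp_sub_left (a := 0) (b := Real.pi / 2) G Real.pi
    simp only [h1, sub_zero] at this
    rw [this]; congr 1; ring
  have a2 : ∫ t in Real.pi..(2 * Real.pi), G t = ∫ t in (0 : ℝ)..Real.pi, G t := by
    have := integral_comp_add_right (a := 0) (b := Real.pi) G Real.pi
    simp only [h2, zero_add] at this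
    rw [this]; congr 1; ring
  have hi : ∀ a b, IntervalIntegrable G volume a b := fun a b => hG.intervalIntegrable a b
  rw [← integral_add_adjacent_intervals (hi 0 Real.pi) (hi _ _), a2,
    ← integral_add_adjacent_intervals (hi 0 (Real.pi / 2)) (hi _ _), a1]
  ring

/-- The cycle around the two turning points has integral `i` times the action. -/
theorem exists_cycle_integral_eq {m : ℂ} (hm : 1 - m ∈ slitPlane) :
    ∃ c : Cycle (2 - 4 * m), c.integral = I * action m := by
  set k := m.sqrt
  have hk : k ^ 2 = m := csqrt_sq m
  let R : ℝ → ℂ := fun t => (1 - m * (Real.sin t : ℂ) ^ 2).sqrt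
  have hR2 : ∀ t, R t ^ 2 = 1 - m * (Real.sin t : ℂ) ^ 2 := fun t => csqrt_sq _
  have hR0 : ∀ t, R t ≠ 0 := csqrt_sin_ne_zero hm
  -- Chosen so that λ - 1/λ = 2i√m sin t, that is, x = m sin² t: the loop runs over the segment from
  -- 0 to m, with w/λ = 2√m cos t.
  let l : ℝ → ℂ := fun t => R t + I * k * (Real.sin t : ℂ)
  have hlinv : ∀ t, (l t)⁻¹ = R t - I * k * (Real.sin t : ℂ) := fun t => by
    refine inv_eq_of_mul_eq_one_left ?_
    simp only [l]
    linear_combination hR2 t - k ^ 2 * (Real.sin t : ℂ) ^ 2 * I_sq + (Real.sin t : ℂ) ^ 2 * hk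
  have hl0 : ∀ t, l t ≠ 0 := fun t h => by
    have h2 := hlinv t
    rw [h, inv_zero] at h2
    simp only [l] at h
    exact hR0 t (by linear_combination (1 / 2 : ℂ) * h - (1 / 2 : ℂ) * h2)
  have hsin : ∀ t, HasDerivAt (fun t : ℝ => (Real.sin t : ℂ)) (Real.cos t : ℂ) t :=
    fun t => (Real.hasDerivAt_sin t).ofReal_comp
  have hRd : ∀ t, HasDerivAt R (-(m * Real.sin t * Real.cos t) / R t) t := fun t => by
    have h := (((hsin t).pow 2).const_mul m).const_sub 1
    refine ((hasDerivAt_csqrt (one_sub_mul_sin_sq_mem_slitPlane hm t)).comp t h).congr_deriv ?_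
    have := hR0 t
    change 1 / (2 * R t) * _ = _
    simp only [Nat.cast_ofNat, Nat.add_one_sub_one, pow_one]
    field_simp
  have hld : ∀ t, HasDerivAt l (I * k * Real.cos t / R t * l t) t := fun t => by
    refine ((hRd t).add ((hsin t).const_mul (I * k))).congr_deriv ?_
    have := hR0 t
    simp only [l]
    field_simp
    linear_combination (-(Real.cos t * Real.sin t : ℂ)) * (k ^ 2 * I_sq - hk)
  have hlc : ContDiff ℝ 1 l := by
    have : ContDiff ℝ 1 R := by
      rw [contDiff_iff_contDiffAt]
      intro t
      refine ContDiffAt.comp (g := Complex.sqrt) t (((contDiffAt_csqrt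
        (one_sub_mul_sin_sq_mem_slitPlane hm t)).restrict_scalars ℝ)) ?_
      have : ContDiff ℝ 1 fun t : ℝ => (Real.sin t : ℂ) :=
        ofRealCLM.contDiff.comp Real.contDiff_sin
      exact (contDiff_const.sub (contDiff_const.mul (this.pow 2))).contDiffAt
    exact this.add (contDiff_const.mul (ofRealCLM.contDiff.comp Real.contDiff_sin))
  have haff : ContDiff ℝ 1 fun t : ℝ => 2 * Real.pi * t := contDiff_const.mul contDiff_id
  have hcos : ContDiff ℝ 1 fun t : ℝ => (Real.cos t : ℂ) :=
    ofRealCLM.contDiff.comp Real.contDiff_cos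
  have hl1 := hlc.comp haff
  have hw1 : ContDiff ℝ 1 fun t : ℝ => 2 * k * l (2 * Real.pi * t) * Real.cos (2 * Real.pi * t) :=
    (contDiff_const.mul hl1).mul (hcos.comp haff)
  have hmem : ∀ t : ℝ, (l (2 * Real.pi * t), 2 * k * l (2 * Real.pi * t) *
      Real.cos (2 * Real.pi * t)) ∈ curve (2 - 4 * m) := fun t => by
    generalize 2 * Real.pi * t = s
    refine ⟨(curve_iff (hl0 s)).2 ?_, hl0 s⟩
    have e : 2 * k * l s * Real.cos s * (l s)⁻¹ = 2 * k * Real.cos s := by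
      have := hl0 s
      field_simp
    have hcs : (Real.cos s : ℂ) ^ 2 = 1 - (Real.sin s : ℂ) ^ 2 := by
      exact_mod_cast Real.cos_sq' s
    rw [e, xCoord, hlinv]
    simp only [l]
    linear_combination 4 * k ^ 2 * hcs - 2 * hR2 s -
      2 * k ^ 2 * (Real.sin s : ℂ) ^ 2 * I_sq + (4 - 2 * (Real.sin s : ℂ) ^ 2) * hk
  refine ⟨Cycle.ofLoop _ _ hl1 hw1 hmem (by simp [l, R]) (by simp [l, R]), ?_⟩
  rw [Cycle.ofLoop_integral]
  let G : ℝ → ℂ := fun t => 2 * I * m * (Real.cos t : ℂ) ^ 2 / R t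
  have hG : Continuous G := by
    have := continuous_csqrt_sin hm
    exact Continuous.div (by fun_prop) this hR0
  have e1 : ∀ t : ℝ, 2 * k * l (2 * Real.pi * t) * Real.cos (2 * Real.pi * t) /
      (l ∘ fun t => 2 * Real.pi * t) t ^ 2 * deriv (l ∘ fun t => 2 * Real.pi * t) t =
      (2 * Real.pi : ℝ) • G (2 * Real.pi * t) := fun t => by
    have h1 : HasDerivAt (fun t : ℝ => 2 * Real.pi * t) (2 * Real.pi) t := by
      simpa using (hasDerivAt_id' t).const_mul (2 * Real.pi)
    rw [((hld _).scomp t h1).deriv]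
    simp only [Function.comp, G, real_smul]
    have := hl0 (2 * Real.pi * t)
    have := hR0 (2 * Real.pi * t)
    rw [← hk]
    field_simp
  rw [integral_congr fun t _ => e1 t, intervalIntegral.integral_smul,
    intervalIntegral.smul_integral_comp_mul_left, mul_zero, mul_one,
    integral_eq_four_mul_quarter hG, action, ← intervalIntegral.integral_const_mul,
    ← intervalIntegral.integral_const_mul]
  · refine integral_congr fun t _ => ?_
    simp only [G, R]
    ring
  · intro t; simp only [G, R, Real.cos_pi_sub, Real.sin_pi_sub, ofReal_neg, neg_sq]
  · intro t; simp only [G, R, Real.cos_add_pi, Real.sin_add_pi, ofReal_neg, neg_sq]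

theorem Solves.re_mul_action {φ : ℝ} {m : ℂ} (h : Solves φ (2 - 4 * m))
    (hm : 1 - m ∈ slitPlane) : (exp (I * φ) * action m).re = 0 := by
  obtain ⟨c, hc⟩ := exists_cycle_integral_eq hm
  have := h c
  rwa [hc, mul_left_comm, I_mul_im] at this

/-- This is the first equation for the rotated problem, with 1 - m in place of m and φ + π/2 in
place of φ. -/
theorem Solves.im_mul_action {φ : ℝ} {m : ℂ} (h : Solves φ (2 - 4 * m))
    (hm : m ∈ slitPlane) : (exp (I * φ) * action (1 - m)).im = 0 := by
  have h1 := h.add_pi_div_two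
  rw [show -(2 - 4 * m) = 2 - 4 * (1 - m) by ring] at h1
  have := h1.re_mul_action (by simpa using hm)
  push_cast at this
  rw [mul_add, exp_add, mul_comm I ((Real.pi : ℂ) / 2), exp_pi_div_two_mul_I, mul_comm (exp _) I,
    mul_assoc, I_mul_re] at this
  exact neg_eq_zero.1 this

/-! ### Periods for real parameters -/

/-- Outside the segment there is a nonzero real period. -/
theorem Solves.sin_eq_zero {φ : ℝ} {m : ℝ} (hm : m < 0) (h : Solves φ (2 - 4 * m)) :
    Real.sin φ = 0 := by
  -- On the unit circle x lies in [0, 1]. For m < 0 the radicand m - x is therefore negative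
  -- throughout, so w/λ is i times a positive function and the two sheets never meet on the circle.
  let l : ℝ → ℂ := fun t => exp ((2 * Real.pi * t : ℝ) * I)
  let S : ℝ → ℝ := fun t => √((2 - 4 * m) - 2 * Real.cos (2 * (2 * Real.pi * t)))
  have hpos : ∀ t, 0 < (2 - 4 * m) - 2 * Real.cos (2 * (2 * Real.pi * t)) := fun t => by
    have := Real.cos_le_one (2 * (2 * Real.pi * t))
    linarith
  have haff : ContDiff ℝ 1 fun t : ℝ => 2 * Real.pi * t := contDiff_const.mul contDiff_id
  have hl : ContDiff ℝ 1 l := ((ofRealCLM.contDiff.comp haff).mul contDiff_const).cexp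
  have hS : ContDiff ℝ 1 S := by
    refine ContDiff.sqrt ?_ fun t => (hpos t).ne'
    exact contDiff_const.sub (contDiff_const.mul
      (Real.contDiff_cos.comp (contDiff_const.mul haff)))
  have hl0 : ∀ t, l t ≠ 0 := fun t => exp_ne_zero _
  have hw : ContDiff ℝ 1 fun t => I * l t * S t :=
    (contDiff_const.mul hl).mul (ofRealCLM.contDiff.comp hS)
  have hmem : ∀ t, (l t, I * l t * S t) ∈ curve (2 - 4 * m) := fun t => by
    refine ⟨(curve_iff (hl0 t)).2 ?_, hl0 t⟩
    have e : I * l t * S t * (l t)⁻¹ = I * S t := by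
      have := hl0 t
      field_simp
    have hS2 : (S t : ℂ) ^ 2 = (2 - 4 * m) - 2 * Complex.cos (2 * (2 * Real.pi * t : ℝ)) := by
      have : S t ^ 2 = (2 - 4 * m) - 2 * Real.cos (2 * (2 * Real.pi * t)) :=
        Real.sq_sqrt (hpos t).le
      have h2 := congrArg (fun x : ℝ => (x : ℂ)) this
      push_cast at h2 ⊢
      exact h2
    have hc : 2 * Complex.cos (2 * (2 * Real.pi * t : ℝ)) = l t ^ 2 + (l t)⁻¹ ^ 2 := by
      simp only [l]
      rw [Complex.cos, ← exp_neg, ← exp_nat_mul, ← exp_nat_mul]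
      push_cast
      ring_nf
    rw [e, xCoord, mul_pow, I_sq, hS2, hc]
    ring
  have hc := h (Cycle.ofLoop l _ hl hw hmem (by simp [l, exp_two_pi_mul_I])
    (by
      have h1 : S 1 = S 0 := by
        simp only [S]
        rw [mul_one, mul_zero, mul_zero, Real.cos_zero,
          show 2 * (2 * Real.pi) = ((2 : ℕ) : ℝ) * (2 * Real.pi) by push_cast; ring,
          Real.cos_nat_mul_two_pi]
      simp [l, exp_two_pi_mul_I, h1]))
  rw [Cycle.ofLoop_integral] at hc
  have e1 : ∀ t, I * l t * S t / l t ^ 2 * deriv l t =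
      ((-(2 * Real.pi) * S t : ℝ) : ℂ) := fun t => by
    have hd : HasDerivAt l (l t * (2 * Real.pi * I)) t := by
      have h1 : HasDerivAt (fun t : ℝ => 2 * Real.pi * t) (2 * Real.pi) t := by
        simpa using (hasDerivAt_id' t).const_mul (2 * Real.pi)
      refine ((h1.ofReal_comp.mul_const I).cexp).congr_deriv ?_
      simp [l]
    rw [hd.deriv]
    have := hl0 t
    field_simp
    rw [I_sq]
    push_cast
    ring
  rw [integral_congr fun t _ => e1 t, intervalIntegral.integral_ofReal, im_mul_ofReal,
    mul_comm I, exp_ofReal_mul_I_im, intervalIntegral.integral_const_mul] at hc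
  have hSpos : 0 < ∫ t in (0 : ℝ)..1, S t :=
    intervalIntegral_pos_of_pos (hS.continuous.intervalIntegrable _ _)
      (fun t => Real.sqrt_pos.2 (hpos t)) zero_lt_one
  have : -(2 * Real.pi) * ∫ t in (0 : ℝ)..1, S t ≠ 0 := by
    have := Real.pi_pos
    exact mul_ne_zero (by linarith) hSpos.ne'
  exact (mul_eq_zero.1 hc).resolve_right this

/-- Below the other turning point the action is real, with the sign of the parameter. -/
theorem exists_action_ofReal {m : ℝ} (hm : m < 1) :
    ∃ r : ℝ, 0 < r ∧ action m = ((m * r : ℝ) : ℂ) := by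
  have hpos : ∀ t, 0 < 1 - m * Real.sin t ^ 2 := fun t => by
    rcases (sq_nonneg (Real.sin t)).eq_or_lt with h | h
    · rw [← h]; norm_num
    · nlinarith [Real.sin_sq_le_one t]
  have hc : Continuous fun t => 8 * Real.cos t ^ 2 / √(1 - m * Real.sin t ^ 2) :=
    Continuous.div (by fun_prop) (by fun_prop) fun t => (Real.sqrt_pos.2 (hpos t)).ne'
  refine ⟨∫ t in (0 : ℝ)..(Real.pi / 2), 8 * Real.cos t ^ 2 / √(1 - m * Real.sin t ^ 2), ?_, ?_⟩
  · refine intervalIntegral_pos_of_pos_on (hc.intervalIntegrable _ _) (fun t ht => ?_)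
      (by positivity)
    have h1 := Real.cos_pos_of_mem_Ioo ⟨by linarith [ht.1, Real.pi_pos], ht.2⟩
    have h2 := Real.sqrt_pos.2 (hpos t)
    positivity
  · rw [← intervalIntegral.integral_const_mul, ← intervalIntegral.integral_ofReal, action]
    refine integral_congr fun t _ => ?_
    rw [show (1 : ℂ) - m * (Real.sin t : ℂ) ^ 2 = ((1 - m * Real.sin t ^ 2 : ℝ) : ℂ) by
      push_cast; ring, csqrt_ofReal (hpos t).le]
    push_cast
    ring

theorem action_zero : action 0 = 0 := by simp [action]

theorem action_one : action 1 = 8 := by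
  have : ∀ t ∈ uIcc (0 : ℝ) (Real.pi / 2),
      8 * 1 * (Real.cos t : ℂ) ^ 2 / Complex.sqrt (1 - 1 * (Real.sin t : ℂ) ^ 2) =
        ((8 * Real.cos t : ℝ) : ℂ) := fun t ht => by
    rw [uIcc_of_le (by positivity)] at ht
    have hc : 0 ≤ Real.cos t := Real.cos_nonneg_of_mem_Icc ⟨by linarith [ht.1, Real.pi_pos], ht.2⟩
    have h2 : (1 : ℂ) - 1 * (Real.sin t : ℂ) ^ 2 = ((Real.cos t ^ 2 : ℝ) : ℂ) := by
      rw [Real.cos_sq']; push_cast; ring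
    rw [h2, csqrt_ofReal (sq_nonneg _), Real.sqrt_sq hc]
    rcases hc.eq_or_lt with h | h
    · simp [← h]
    · have : (Real.cos t : ℂ) ≠ 0 := by exact_mod_cast h.ne'
      push_cast
      push_cast at this
      field_simp
  rw [action, integral_congr this, intervalIntegral.integral_ofReal,
    intervalIntegral.integral_const_mul, integral_cos]
  simp

/-! ### Arguments of the actions and location of nonreal solutions -/

theorem im_mul_integral_pos_of_intervalIntegrable {G : ℝ → ℂ} {a b : ℝ}
    (hG : IntervalIntegrable G volume a b) (hab : a < b) (c : ℂ)
    (h : ∀ t ∈ Ioo a b, 0 < (c * G t).im) : 0 < (c * ∫ t in a..b, G t).im := by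
  have hc := hG.const_mul c
  rw [← intervalIntegral.integral_const_mul]
  have e := imCLM.intervalIntegral_comp_comm hc
  simp only [imCLM_apply] at e
  rw [← e]
  exact intervalIntegral_pos_of_pos_on
    ⟨imCLM.integrable_comp hc.1, imCLM.integrable_comp hc.2⟩ h hab

theorem im_mul_integral_pos {G : ℝ → ℂ} (hG : Continuous G) {a b : ℝ} (hab : a < b) (c : ℂ)
    (h : ∀ t ∈ Ioo a b, 0 < (c * G t).im) : 0 < (c * ∫ t in a..b, G t).im :=
  im_mul_integral_pos_of_intervalIntegrable (hG.intervalIntegrable a b) hab c h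

/-- The action divided by `8 m`. -/
def actionMean (m : ℂ) : ℂ :=
  ∫ t in (0 : ℝ)..(Real.pi / 2),
    (Real.cos t : ℂ) ^ 2 / Complex.sqrt (1 - m * (Real.sin t : ℂ) ^ 2)

theorem action_eq_actionMean (m : ℂ) : action m = 8 * m * actionMean m := by
  rw [action, actionMean, ← intervalIntegral.integral_const_mul]
  refine integral_congr fun t _ => ?_
  ring

theorem continuous_actionMean_integrand {m : ℂ} (hm : 1 - m ∈ slitPlane) :
    Continuous fun t : ℝ => (Real.cos t : ℂ) ^ 2 / (1 - m * (Real.sin t : ℂ) ^ 2).sqrt :=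
  Continuous.div (by fun_prop) (continuous_csqrt_sin hm) (csqrt_sin_ne_zero hm)

theorem one_sub_mem_slitPlane_of_im_ne_zero {m : ℂ} (hm : m.im ≠ 0) : 1 - m ∈ slitPlane :=
  Or.inr (by simpa using hm)

theorem sin_cos_pos {t : ℝ} (ht : t ∈ Ioo (0 : ℝ) (Real.pi / 2)) :
    0 < Real.sin t ∧ 0 < Real.cos t :=
  ⟨Real.sin_pos_of_pos_of_lt_pi ht.1 (by linarith [ht.2, Real.pi_pos]),
    Real.cos_pos_of_mem_Ioo ⟨by linarith [ht.1, Real.pi_pos], ht.2⟩⟩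

theorem csqrt_sin_im_neg {m : ℂ} (hm : 0 < m.im) {t : ℝ} (ht : t ∈ Ioo (0 : ℝ) (Real.pi / 2)) :
    (1 - m * (Real.sin t : ℂ) ^ 2).sqrt.im < 0 := by
  apply csqrt_im_neg
  rw [← ofReal_pow]
  simp only [sub_im, one_im, im_mul_ofReal]
  have := mul_pos hm (pow_pos (sin_cos_pos ht).1 2)
  linarith

theorem actionMean_re_pos {m : ℂ} (hm : 0 < m.im) : 0 < (actionMean m).re := by
  have hs := one_sub_mem_slitPlane_of_im_ne_zero hm.ne'
  have := im_mul_integral_pos (continuous_actionMean_integrand hs)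
    (by positivity : (0 : ℝ) < Real.pi / 2) I fun t ht => by
      have h1 := csqrt_re_pos (one_sub_mul_sin_sq_mem_slitPlane hs t)
      have h2 := normSq_pos.2 (csqrt_sin_ne_zero hs t)
      have h3 := (sin_cos_pos ht).2
      rw [I_mul_im, ← ofReal_pow, div_eq_mul_inv, re_ofReal_mul, inv_re]
      positivity
  rwa [I_mul_im] at this

theorem actionMean_im_pos {m : ℂ} (hm : 0 < m.im) : 0 < (actionMean m).im := by
  have hs := one_sub_mem_slitPlane_of_im_ne_zero hm.ne'
  have := im_mul_integral_pos (continuous_actionMean_integrand hs)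
    (by positivity : (0 : ℝ) < Real.pi / 2) 1 fun t ht => by
      have h1 := neg_pos.2 (csqrt_sin_im_neg hm ht)
      have h2 := normSq_pos.2 (csqrt_sin_ne_zero hs t)
      have h3 := (sin_cos_pos ht).2
      rw [one_mul, ← ofReal_pow, div_eq_mul_inv, im_ofReal_mul, inv_im]
      positivity
  rwa [one_mul] at this

/-- For Im m > 0 the root p of 1 - m sin² t has argument strictly between that of q = √(1 - m) and
0, so each value q/p lies in the lower half-plane. This is the upper bound on the argument used in
`arg_actionMean`. -/
theorem actionMean_mul_csqrt_im_neg {m : ℂ} (hm : 0 < m.im) :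
    (actionMean m * (1 - m).sqrt).im < 0 := by
  have hs := one_sub_mem_slitPlane_of_im_ne_zero hm.ne'
  have hq1 := csqrt_re_pos hs
  have hq2 : (1 - m).sqrt.im < 0 := csqrt_im_neg (by simpa using hm)
  have := im_mul_integral_pos (continuous_actionMean_integrand hs)
    (by positivity : (0 : ℝ) < Real.pi / 2) (-(1 - m).sqrt) fun t ht => by
      have h1 := csqrt_re_pos (one_sub_mul_sin_sq_mem_slitPlane hs t)
      have h2 := normSq_pos.2 (csqrt_sin_ne_zero hs t)
      have h3 := (sin_cos_pos ht).2
      have h4 := csqrt_sin_im_neg hm ht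
      have e1 := csqrt_sq (1 - m)
      have e2 := csqrt_sq (1 - m * (Real.sin t : ℂ) ^ 2)
      generalize (1 - m).sqrt = q at *
      generalize (1 - m * (Real.sin t : ℂ) ^ 2).sqrt = p at *
      -- The product is half the imaginary part of (q p̄)² = (1 - m) times the conjugate of 1 - m
      -- sin² t, so its sign is explicit; the second factor is positive.
      have key : (q.im * p.re - q.re * p.im) * (q.re * p.re + q.im * p.im) < 0 := by
        have a1 := congrArg re e1
        have a2 := congrArg im e1
        have b1 := congrArg re e2
        have b2 := congrArg im e2
        rw [← ofReal_pow] at b1 b2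
        simp only [sq, sub_re, sub_im, one_re, one_im, mul_re, mul_im, ofReal_re, ofReal_im,
          mul_zero, sub_zero, zero_add] at a1 a2 b1 b2
        have hcs := Real.sin_sq_add_cos_sq t
        have : (q.im * p.re - q.re * p.im) * (q.re * p.re + q.im * p.im) =
            -(m.im * Real.cos t ^ 2) / 2 := by
          have : 2 * ((q.im * p.re - q.re * p.im) * (q.re * p.re + q.im * p.im)) =
            (q.re * q.im + q.im * q.re) * (p.re * p.re - p.im * p.im) -
            (q.re * q.re - q.im * q.im) * (p.re * p.im + p.im * p.re) := by ring
          rw [a1, a2, b1, b2] at this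
          linear_combination (1 / 2) * this + (m.im / 2) * hcs
        rw [this]
        have := mul_pos hm (pow_pos h3 2)
        linarith
      have hpos : 0 < q.re * p.re + q.im * p.im :=
        add_pos (mul_pos hq1 h1) (mul_pos_of_neg_of_neg hq2 h4)
      have hneg : q.im * p.re - q.re * p.im < 0 := by
        by_contra hcon
        have := mul_nonneg (not_lt.1 hcon) hpos.le
        linarith
      have e3 : -q * ((Real.cos t : ℂ) ^ 2 / p) = ((Real.cos t ^ 2 : ℝ) : ℂ) * (-q / p) := by
        push_cast; ring
      rw [e3, im_ofReal_mul, div_im, neg_im, neg_re]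
      have : -q.im * p.re / normSq p - -q.re * p.im / normSq p =
          -(q.im * p.re - q.re * p.im) / normSq p := by ring
      rw [this]
      have := neg_pos.2 hneg
      positivity
  rw [mul_comm]
  change 0 < (-(1 - m).sqrt * actionMean m).im at this
  rw [neg_mul, neg_im] at this
  linarith

theorem arg_pos_of_im_pos {z : ℂ} (hz : 0 < z.im) : 0 < z.arg :=
  lt_of_le_of_ne (arg_nonneg_iff.2 hz.le) fun h => hz.ne' (arg_eq_zero_iff.1 h.symm).2

theorem arg_lt_pi_of_im_ne_zero {z : ℂ} (hz : z.im ≠ 0) : z.arg < Real.pi :=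
  arg_lt_pi_iff.2 (Or.inr hz)

theorem arg_csqrt {z : ℂ} (hz : z ≠ 0) : z.sqrt.arg = z.arg / 2 := by
  have h1 := neg_pi_lt_arg z
  have h2 := arg_le_pi z
  have hp := Real.pi_pos
  have him : (log z / 2).im = z.arg / 2 := by
    rw [← ofReal_ofNat, div_ofReal_im, log_im]
  rw [sqrt_eq_exp hz, ← log_im, log_exp, him]
  · rw [him]; linarith
  · rw [him]; linarith

theorem arg_actionMean {m : ℂ} (hm : 0 < m.im) :
    0 < (actionMean m).arg ∧ (actionMean m).arg < -(1 - m).arg / 2 := by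
  have h1 := actionMean_re_pos hm
  have h2 := actionMean_im_pos hm
  have h3 := actionMean_mul_csqrt_im_neg hm
  have hs := slitPlane_ne_zero (one_sub_mem_slitPlane_of_im_ne_zero hm.ne')
  have hN : actionMean m ≠ 0 := fun h => by rw [h] at h1; simp at h1
  have hpos := arg_pos_of_im_pos h2
  refine ⟨hpos, ?_⟩
  have ha := abs_lt.1 (abs_arg_lt_pi_div_two_iff.2 (Or.inl h1))
  have hb := neg_pi_lt_arg (1 - m)
  have hb' : (1 - m).arg < 0 := arg_neg_iff.2 (by simpa using hm)
  have := arg_mul hN (csqrt_ne_zero hs) (by rw [arg_csqrt hs]; constructor <;> linarith)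
  rw [arg_csqrt hs] at this
  have h4 := arg_neg_iff.2 h3
  linarith

theorem mul_conj_eq_polar (z w : ℂ) :
    z * starRingEnd ℂ w = ((‖z‖ * ‖w‖ : ℝ) : ℂ) * exp ((z.arg - w.arg : ℝ) * I) := by
  have hw : starRingEnd ℂ w = ‖w‖ * exp (-(w.arg * I)) := by
    conv_lhs => rw [← norm_mul_exp_arg_mul_I w]
    rw [map_mul, conj_ofReal, ← exp_conj, map_mul, conj_ofReal, conj_I, mul_neg]
  conv_lhs => rw [hw, ← norm_mul_exp_arg_mul_I z]
  push_cast
  rw [sub_mul, sub_eq_add_neg, exp_add]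
  ring

theorem exp_mul_eq_polar (φ : ℝ) (z w : ℂ) : exp (I * φ) * (8 * z * w) =
    ((8 * ‖z‖ * ‖w‖ : ℝ) : ℂ) * exp ((φ + z.arg + w.arg : ℝ) * I) := by
  conv_lhs => rw [← norm_mul_exp_arg_mul_I z, ← norm_mul_exp_arg_mul_I w]
  push_cast
  rw [add_mul, add_mul, exp_add, exp_add, mul_comm I]
  ring

theorem exp_mul_conj_eq_polar (φ : ℝ) (z w : ℂ) : exp (I * φ) * (8 * z * starRingEnd ℂ w) =
    ((8 * ‖z‖ * ‖w‖ : ℝ) : ℂ) * exp ((φ + z.arg - w.arg : ℝ) * I) := by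
  rw [mul_assoc (8 : ℂ), mul_conj_eq_polar]
  push_cast
  rw [add_sub_assoc, add_mul, exp_add, mul_comm I]
  ring

/-- The two arguments are, up to sign, the angles at 0 and 1 of the triangle with vertices 0, 1, m.
Analytically, the product of m with the conjugate of 1 - m has imaginary part Im m > 0. -/
theorem arg_sub_arg_lt_pi {m : ℂ} (hm : 0 < m.im) : m.arg - (1 - m).arg < Real.pi := by
  have h1 := arg_pos_of_im_pos hm
  have h2 := arg_lt_pi_of_im_ne_zero hm.ne'
  have h3 : (1 - m).arg < 0 := arg_neg_iff.2 (by simpa using hm)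
  have h4 := neg_pi_lt_arg (1 - m)
  have e : (m * starRingEnd ℂ (1 - m)).im = ‖m‖ * ‖1 - m‖ * Real.sin (m.arg - (1 - m).arg) := by
    rw [mul_conj_eq_polar, im_ofReal_mul, exp_ofReal_mul_I_im]
  have e2 : (m * starRingEnd ℂ (1 - m)).im = m.im := by
    simp; ring
  by_contra hcon
  rw [not_lt] at hcon
  have h5 : Real.sin (m.arg - (1 - m).arg) ≤ 0 := by
    rw [← neg_nonneg, ← Real.sin_sub_pi]
    exact Real.sin_nonneg_of_nonneg_of_le_pi (by linarith) (by linarith)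
  have := mul_nonpos_of_nonneg_of_nonpos (by positivity : 0 ≤ ‖m‖ * ‖1 - m‖) h5
  rw [← e, e2] at this
  linarith

theorem actionMean_conj {m : ℂ} (hm : 1 - m ∈ slitPlane) :
    actionMean (starRingEnd ℂ m) = starRingEnd ℂ (actionMean m) := by
  rw [actionMean, actionMean, ← intervalIntegral_conj]
  refine integral_congr fun t _ => ?_
  simp only [map_div₀, map_pow, conj_ofReal]
  rw [← csqrt_conj (one_sub_mul_sin_sq_mem_slitPlane hm t), map_sub, map_one, map_mul, map_pow,
    conj_ofReal]

/-- The angles of a solution in the upper half-plane. -/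
theorem exists_angle {φ : ℝ} {m : ℂ} (hm : 0 < m.im) (h0 : (exp (I * φ) * action m).re = 0)
    (h1 : (exp (I * φ) * action (1 - m)).im = 0) :
    ∃ (θ : ℝ) (k : ℤ), φ = θ + k * Real.pi ∧ 0 < θ ∧ θ < Real.pi / 2 ∧
      m.arg < Real.pi / 2 - θ ∧ -(1 - m).arg < θ := by
  have hp := Real.pi_pos
  have hm' : 0 < (1 - starRingEnd ℂ m).im := by simpa using hm
  have hα := arg_pos_of_im_pos hm
  have hβ : (1 - m).arg < 0 := arg_neg_iff.2 (by simpa using hm)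
  have hαβ := arg_sub_arg_lt_pi hm
  obtain ⟨hμ, hμ'⟩ := arg_actionMean hm
  obtain ⟨hν, hν'⟩ := arg_actionMean hm'
  rw [sub_sub_cancel, arg_conj, if_neg (arg_lt_pi_of_im_ne_zero hm.ne').ne, neg_neg] at hν'
  have hmean : actionMean (1 - m) = starRingEnd ℂ (actionMean (1 - starRingEnd ℂ m)) := by
    rw [← actionMean_conj (one_sub_mem_slitPlane_of_im_ne_zero hm'.ne')]
    simp
  have hne : actionMean m ≠ 0 := fun h => by
    have := actionMean_im_pos hm; rw [h] at this; simp at this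
  have hne' : actionMean (1 - starRingEnd ℂ m) ≠ 0 := fun h => by
    have := actionMean_im_pos hm'; rw [h] at this; simp at this
  have hm0 := ne_zero_of_im_ne_zero hm.ne'
  have hm1 := one_sub_ne_zero_of_im_ne_zero hm.ne'
  rw [action_eq_actionMean] at h0 h1
  rw [hmean] at h1
  set μ := (actionMean m).arg
  set ν := (actionMean (1 - starRingEnd ℂ m)).arg
  rw [exp_mul_eq_polar, re_ofReal_mul, exp_ofReal_mul_I_re, mul_eq_zero,
    or_iff_right (by positivity)] at h0
  rw [exp_mul_conj_eq_polar, im_ofReal_mul, exp_ofReal_mul_I_im, mul_eq_zero,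
    or_iff_right (by positivity)] at h1
  obtain ⟨k, hk⟩ := Real.sin_eq_zero_iff.1 h1
  have hφ : φ = (-(1 - m).arg + ν) + k * Real.pi := by linarith
  have hcos : Real.cos (-(1 - m).arg + ν + m.arg + μ) = 0 := by
    rw [show φ + m.arg + μ = (-(1 - m).arg + ν + m.arg + μ) + k * Real.pi by linarith,
      Real.cos_add_int_mul_pi] at h0
    refine (mul_eq_zero.1 h0).resolve_left ?_
    exact zpow_ne_zero _ (by norm_num)
  -- The mean arguments satisfy μ < -arg(1 - m)/2 and ν < arg(m)/2, so the sum lies strictly between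
  -- 0 and 3π/2. The only zero of the cosine there is π/2.
  have hsum : -(1 - m).arg + ν + m.arg + μ = Real.pi / 2 := by
    obtain ⟨n, hn⟩ := Real.cos_eq_zero_iff.1 hcos
    have hn0 : n = 0 := by
      have b1 : (-1 : ℝ) < n := by
        by_contra hcon
        have : 2 * (n : ℝ) + 1 ≤ -1 := by linarith
        nlinarith
      have b2 : (n : ℝ) < 1 := by
        by_contra hcon
        have : 3 ≤ 2 * (n : ℝ) + 1 := by linarith
        nlinarith
      have b1' : -1 < n := by exact_mod_cast b1
      have b2' : n < 1 := by exact_mod_cast b2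
      omega
    rw [hn, hn0]; push_cast; ring
  refine ⟨-(1 - m).arg + ν, k, hφ, by linarith, by linarith, by linarith, by linarith⟩

/-! ### The derivative of the action -/

/-- The derivative of the action: a complete elliptic integral of the first kind. -/
def period (m : ℂ) : ℂ :=
  ∫ t in (0 : ℝ)..(Real.pi / 2), 4 / Complex.sqrt (1 - m * (Real.sin t : ℂ) ^ 2)

theorem isOpen_one_sub_mem_slitPlane : IsOpen {m : ℂ | 1 - m ∈ slitPlane} :=
  isOpen_slitPlane.preimage (f := fun m : ℂ => 1 - m) (by fun_prop)

theorem continuousOn_csqrt_sin (s : Set ℝ) :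
    ContinuousOn (fun p : ℂ × ℝ => (1 - p.1 * (Real.sin p.2 : ℂ) ^ 2).sqrt)
      ({m : ℂ | 1 - m ∈ slitPlane} ×ˢ s) := fun p hp =>
  (ContinuousAt.comp (g := Complex.sqrt) (f := fun p : ℂ × ℝ => 1 - p.1 * (Real.sin p.2 : ℂ) ^ 2)
    (continuousAt_csqrt (one_sub_mul_sin_sq_mem_slitPlane hp.1 p.2))
    (by fun_prop)).continuousWithinAt

theorem continuous_period_integrand {m : ℂ} (hm : 1 - m ∈ slitPlane) :
    Continuous fun t : ℝ => 4 / (1 - m * (Real.sin t : ℂ) ^ 2).sqrt :=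
  Continuous.div (by fun_prop) (continuous_csqrt_sin hm) (csqrt_sin_ne_zero hm)

theorem hasDerivAt_action {m : ℂ} (hm : 1 - m ∈ slitPlane) :
    HasDerivAt action (period m) m := by
  let R : ℂ → ℝ → ℂ := fun m t => (1 - m * (Real.sin t : ℂ) ^ 2).sqrt
  have hR0 : ∀ m, 1 - m ∈ slitPlane → ∀ t, R m t ≠ 0 := fun m hm t => csqrt_sin_ne_zero hm t
  have hR2 : ∀ m t, R m t ^ 2 = 1 - m * (Real.sin t : ℂ) ^ 2 := fun m t => csqrt_sq _
  have key := hasDerivAt_integral_of_continuousOn isOpen_one_sub_mem_slitPlane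
    (a := 0) (b := Real.pi / 2)
    (F := fun m t => 8 * m * (Real.cos t : ℂ) ^ 2 / R m t)
    (F' := fun m t => 8 * (Real.cos t : ℂ) ^ 2 / R m t +
      4 * m * (Real.cos t : ℂ) ^ 2 * (Real.sin t : ℂ) ^ 2 / R m t ^ 3)
    (fun m hm => (Continuous.div (by fun_prop) (continuous_csqrt_sin hm) (hR0 m hm)).continuousOn)
    (by
      refine ContinuousOn.add (ContinuousOn.div (by fun_prop) (continuousOn_csqrt_sin _)
        fun p hp => hR0 _ hp.1 _) (ContinuousOn.div (by fun_prop)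
          ((continuousOn_csqrt_sin _).pow 3) fun p hp => pow_ne_zero 3 (hR0 _ hp.1 _)))
    (fun m hm t _ => by
      have h1 := HasDerivAt.csqrt
        (((hasDerivAt_id' m).mul_const ((Real.sin t : ℂ) ^ 2)).const_sub 1)
        (one_sub_mul_sin_sq_mem_slitPlane hm t)
      have h2 := (((hasDerivAt_id' m).const_mul 8).mul_const ((Real.cos t : ℂ) ^ 2)).div h1
        (csqrt_sin_ne_zero hm t)
      refine h2.congr_deriv ?_
      have := hR0 m hm t
      change (_ * R m t - _ * (_ / (2 * R m t))) / R m t ^ 2 = _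
      field_simp
      ring) hm
  refine key.congr_deriv ?_
  have hsin : ∀ t, HasDerivAt (fun t : ℝ => (Real.sin t : ℂ)) (Real.cos t : ℂ) t :=
    fun t => (Real.hasDerivAt_sin t).ofReal_comp
  have hcos : ∀ t, HasDerivAt (fun t : ℝ => (Real.cos t : ℂ)) (-Real.sin t : ℂ) t := fun t => by
    simpa using (Real.hasDerivAt_cos t).ofReal_comp
  have hRd : ∀ t, HasDerivAt (R m) (-(m * Real.sin t * Real.cos t) / R m t) t := fun t => by
    have h := (((hsin t).pow 2).const_mul m).const_sub 1
    refine ((hasDerivAt_csqrt (one_sub_mul_sin_sq_mem_slitPlane hm t)).comp t h).congr_deriv ?_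
    have := hR0 m hm t
    change 1 / (2 * R m t) * _ = _
    simp only [Nat.cast_ofNat, Nat.add_one_sub_one, pow_one]
    field_simp
  have hRc : Continuous (R m) := continuous_csqrt_sin hm
  have hc1 : Continuous fun t : ℝ => 8 * (Real.cos t : ℂ) ^ 2 / R m t +
      4 * m * (Real.cos t : ℂ) ^ 2 * (Real.sin t : ℂ) ^ 2 / R m t ^ 3 :=
    (Continuous.div (by fun_prop) hRc (hR0 m hm)).add (Continuous.div (by fun_prop) (hRc.pow 3)
      fun t => pow_ne_zero 3 (hR0 m hm t))
  have hc2 := continuous_period_integrand hm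
  -- The differentiated integrand and that of `period` differ by the derivative of 4 sin t cos t /
  -- R, which vanishes at both ends.
  have ftc := integral_eq_sub_of_hasDerivAt (a := 0) (b := Real.pi / 2)
    (f := fun t => 4 * ((Real.sin t : ℂ) * (Real.cos t : ℂ)) / R m t)
    (f' := fun t => (8 * (Real.cos t : ℂ) ^ 2 / R m t +
      4 * m * (Real.cos t : ℂ) ^ 2 * (Real.sin t : ℂ) ^ 2 / R m t ^ 3) - 4 / R m t)
    (fun t _ => by
      refine ((((hsin t).mul (hcos t)).const_mul 4).div (hRd t) (hR0 m hm t)).congr_deriv ?_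
      have h0 := hR0 m hm t
      have hcs : (Real.sin t : ℂ) ^ 2 + (Real.cos t : ℂ) ^ 2 = 1 := by
        exact_mod_cast Real.sin_sq_add_cos_sq t
      simp only [Pi.mul_apply]
      field_simp
      linear_combination (-4 : ℂ) * R m t ^ 2 * hcs)
    ((hc1.sub hc2).intervalIntegrable _ _)
  rw [intervalIntegral.integral_sub (hc1.intervalIntegrable _ _) (hc2.intervalIntegrable _ _),
    Real.cos_pi_div_two, Real.sin_zero] at ftc
  simp only [ofReal_zero, mul_zero, zero_mul, zero_div, sub_zero] at ftc
  exact sub_eq_zero.1 ftc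

theorem contDiffAt_action {m : ℂ} (hm : 1 - m ∈ slitPlane) : ContDiffAt ℂ ∞ action m := by
  have : DifferentiableOn ℂ action {m : ℂ | 1 - m ∈ slitPlane} := fun m hm =>
    (hasDerivAt_action hm).differentiableAt.differentiableWithinAt
  exact (this.contDiffOn isOpen_one_sub_mem_slitPlane).contDiffAt
    (isOpen_one_sub_mem_slitPlane.mem_nhds hm)

/-! ### The triangle, the quadrant estimate and uniqueness -/

/-- The triangle with right angle at its third vertex `i sin φ e^{-iφ}` and base `[0, 1]`. -/
def triangle (φ : ℝ) : Set ℂ :=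
  {m | 0 < m.im ∧ 0 < (exp (I * φ) * m).re ∧ 0 < (exp (I * φ) * (1 - m)).im}

theorem exp_mul_re (φ : ℝ) (z : ℂ) :
    (exp (I * φ) * z).re = Real.cos φ * z.re - Real.sin φ * z.im := by
  rw [mul_re, mul_comm I, exp_ofReal_mul_I_re, exp_ofReal_mul_I_im]

theorem exp_mul_im (φ : ℝ) (z : ℂ) :
    (exp (I * φ) * z).im = Real.cos φ * z.im + Real.sin φ * z.re := by
  rw [mul_im, mul_comm I, exp_ofReal_mul_I_re, exp_ofReal_mul_I_im]

theorem convex_triangle (φ : ℝ) : Convex ℝ (triangle φ) := by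
  rintro z ⟨h1, h2, h3⟩ w ⟨k1, k2, k3⟩ a b ha hb hab
  simp only [triangle, mem_ofPred_eq, exp_mul_re, exp_mul_im, real_smul, add_re, add_im,
    re_ofReal_mul, im_ofReal_mul, sub_re, sub_im, one_re, one_im] at *
  have key : ∀ x y : ℝ, 0 < x → 0 < y → 0 < a * x + b * y := fun x y hx hy => by
    rcases ha.eq_or_lt with h | h
    · rw [← h] at hab ⊢
      have : b = 1 := by linarith
      rw [this]; linarith
    · have := mul_pos h hx
      have := mul_nonneg hb hy.le
      linarith
  refine ⟨key _ _ h1 k1, ?_, ?_⟩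
  · have := key _ _ h2 k2
    linarith
  · have := key _ _ h3 k3
    have : a * Real.sin φ + b * Real.sin φ = Real.sin φ := by rw [← add_mul, hab, one_mul]
    linarith

theorem sin_cos_half_pos {φ : ℝ} (h0 : 0 < φ) (h1 : φ < Real.pi / 2) :
    0 < Real.sin (φ / 2) ∧ Real.sin (φ / 2) < Real.cos (φ / 2) := by
  have hp := Real.pi_pos
  have hs := Real.sin_pos_of_pos_of_lt_pi (x := φ / 2) (by linarith) (by linarith)
  have hc := Real.cos_pos_of_mem_Ioo (x := φ / 2) ⟨by linarith, by linarith⟩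
  have hcc := Real.cos_pos_of_mem_Ioo (x := φ) ⟨by linarith, h1⟩
  refine ⟨hs, ?_⟩
  have := Real.cos_two_mul' (φ / 2)
  rw [show 2 * (φ / 2) = φ by ring] at this
  nlinarith

theorem re_pos_of_mem_triangle {φ : ℝ} (h0 : 0 < φ) (h1 : φ < Real.pi / 2) {m : ℂ}
    (hm : m ∈ triangle φ) : 0 < m.re := by
  have hp := Real.pi_pos
  have hs := Real.sin_pos_of_pos_of_lt_pi (x := φ) h0 (by linarith)
  have hc := Real.cos_pos_of_mem_Ioo (x := φ) ⟨by linarith, h1⟩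
  have := hm.2.1
  rw [exp_mul_re] at this
  have := mul_pos hs hm.1
  by_contra hcon
  have := mul_nonneg hc.le (neg_nonneg.2 (not_lt.1 hcon))
  linarith

/-- The rotated square root lies in the open first quadrant. -/
theorem exp_mul_csqrt_of_mem_triangle {φ : ℝ} (h0 : 0 < φ) (h1 : φ < Real.pi / 2) {m : ℂ}
    (hm : m ∈ triangle φ) {t : ℝ} (ht : t ∈ Ioo (0 : ℝ) (Real.pi / 2)) :
    0 < (exp (I * (φ / 2 : ℝ)) * (1 - m * (Real.sin t : ℂ) ^ 2).sqrt).re ∧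
      0 < (exp (I * (φ / 2 : ℝ)) * (1 - m * (Real.sin t : ℂ) ^ 2).sqrt).im := by
  obtain ⟨hs, hsc⟩ := sin_cos_half_pos h0 h1
  have hre := csqrt_re_pos (one_sub_mul_sin_sq_mem_slitPlane
    (one_sub_mem_slitPlane_of_im_ne_zero hm.1.ne') t)
  have him := csqrt_sin_im_neg hm.1 ht
  have e := csqrt_sq (1 - m * (Real.sin t : ℂ) ^ 2)
  generalize (1 - m * (Real.sin t : ℂ) ^ 2).sqrt = p at *
  have hre' : 0 < (exp (I * (φ / 2 : ℝ)) * p).re := by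
    rw [exp_mul_re]
    have := mul_pos (hs.trans hsc) hre
    have := mul_pos hs (neg_pos.2 him)
    linarith
  refine ⟨hre', ?_⟩
  -- The square is a convex combination of e^{iφ} and e^{iφ}(1 - m), both in the upper half-plane.
  have hsq : 0 < ((exp (I * (φ / 2 : ℝ)) * p) ^ 2).im := by
    rw [mul_pow, ← exp_nat_mul, e,
      show ((2 : ℕ) : ℂ) * (I * (φ / 2 : ℝ)) = I * φ by push_cast; ring,
      show exp (I * φ) * (1 - m * (Real.sin t : ℂ) ^ 2) = ((1 - Real.sin t ^ 2 : ℝ) : ℂ) *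
        exp (I * φ) + ((Real.sin t ^ 2 : ℝ) : ℂ) * (exp (I * φ) * (1 - m)) by push_cast; ring,
      add_im, im_ofReal_mul, im_ofReal_mul, mul_comm I, exp_ofReal_mul_I_im, mul_comm (φ : ℂ)]
    have h2 := hm.2.2
    have h3 := (sin_cos_pos ht).1
    have h4 := Real.sin_pos_of_pos_of_lt_pi (x := φ) h0 (by linarith [Real.pi_pos])
    have h5 : 0 ≤ 1 - Real.sin t ^ 2 := by linarith [Real.sin_sq_le_one t]
    positivity
  rw [sq, mul_im] at hsq
  by_contra hcon
  have := mul_nonneg hre'.le (neg_nonneg.2 (not_lt.1 hcon))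
  linarith

/-- Since Re m > 0, the radicand has positive real part and nonnegative imaginary part, so the root
has argument in [0, π/4). Adding φ/2, which lies in (0, π/4), leaves it in the open quadrant. -/
theorem exp_mul_csqrt_one_sub_of_mem_triangle {φ : ℝ} (h0 : 0 < φ) (h1 : φ < Real.pi / 2) {m : ℂ}
    (hm : m ∈ triangle φ) {t : ℝ} (ht : t ∈ Ioo (0 : ℝ) (Real.pi / 2)) :
    0 < (exp (I * (φ / 2 : ℝ)) * (1 - (1 - m) * (Real.sin t : ℂ) ^ 2).sqrt).re ∧
      0 < (exp (I * (φ / 2 : ℝ)) * (1 - (1 - m) * (Real.sin t : ℂ) ^ 2).sqrt).im := by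
  obtain ⟨hs, hsc⟩ := sin_cos_half_pos h0 h1
  have hre := csqrt_re_pos (one_sub_mul_sin_sq_mem_slitPlane (m := 1 - m)
    (by rw [sub_sub_cancel]; exact Or.inr hm.1.ne') t)
  have hmr := re_pos_of_mem_triangle h0 h1 hm
  obtain ⟨hst, hct⟩ := sin_cos_pos ht
  have him : 0 ≤ (1 - (1 - m) * (Real.sin t : ℂ) ^ 2).sqrt.im := by
    apply csqrt_im_nonneg
    rw [← ofReal_pow, sub_im, im_mul_ofReal, sub_im, one_im]
    have := mul_pos hm.1 (pow_pos hst 2)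
    linarith
  have e := congrArg re (csqrt_sq (1 - (1 - m) * (Real.sin t : ℂ) ^ 2))
  rw [← ofReal_pow] at e him hre ⊢
  generalize (1 - (1 - m) * ((Real.sin t ^ 2 : ℝ) : ℂ)).sqrt = p at *
  rw [sq, mul_re, sub_re, re_mul_ofReal, sub_re, one_re] at e
  have hsq : 0 < p.re * p.re - p.im * p.im := by
    rw [e]
    have := mul_pos hmr (pow_pos hst 2)
    have := Real.sin_sq_le_one t
    linarith
  have hlt : p.im < p.re := by
    by_contra hcon
    have := mul_self_le_mul_self hre.le (not_lt.1 hcon)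
    linarith
  rw [exp_mul_re, exp_mul_im]
  constructor
  · have a1 := mul_lt_mul_of_pos_right hsc hre
    have a2 := mul_lt_mul_of_pos_left hlt hs
    linarith
  · have a1 := mul_nonneg (hs.trans hsc).le him
    have a2 := mul_pos hs hre
    linarith

/-- A complex integral lies in the open fourth quadrant, after rotation, if the rotated reciprocals
of the values of the integrand lie in the first. -/
theorem integral_div_mem_quadrant {p : ℝ → ℂ} (hc : Continuous fun t => 4 / p t) {a b : ℝ}
    (hab : a < b) (E : ℂ)
    (h : ∀ t ∈ Ioo a b, 0 < (E * p t).re ∧ 0 < (E * p t).im) :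
    0 < (E⁻¹ * ∫ t in a..b, 4 / p t).re ∧ (E⁻¹ * ∫ t in a..b, 4 / p t).im < 0 := by
  have key : ∀ t, E⁻¹ * (4 / p t) = ((4 : ℝ) : ℂ) * (E * p t)⁻¹ := fun t => by
    rw [mul_inv]; push_cast; ring
  have hn : ∀ t ∈ Ioo a b, 0 < normSq (E * p t) := fun t ht =>
    normSq_pos.2 fun h0 => by have := (h t ht).1; rw [h0] at this; simp at this
  constructor
  · have := im_mul_integral_pos hc hab (I * E⁻¹) fun t ht => by
      have h1 := hn t ht
      have h2 := (h t ht).1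
      rw [mul_assoc, key, I_mul_im, re_ofReal_mul, inv_re]
      positivity
    rwa [mul_assoc, I_mul_im] at this
  · have := im_mul_integral_pos hc hab (-E⁻¹) fun t ht => by
      have h1 := hn t ht
      have h2 := (h t ht).2
      rw [neg_mul, neg_im, key, im_ofReal_mul, inv_im, neg_div, mul_neg, neg_neg]
      positivity
    rw [neg_mul, neg_im] at this
    linarith

theorem period_mem_quadrant {φ : ℝ} (h0 : 0 < φ) (h1 : φ < Real.pi / 2) {m : ℂ}
    (hm : m ∈ triangle φ) : 0 < ((exp (I * (φ / 2 : ℝ)))⁻¹ * period m).re ∧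
      ((exp (I * (φ / 2 : ℝ)))⁻¹ * period m).im < 0 :=
  integral_div_mem_quadrant (continuous_period_integrand
    (one_sub_mem_slitPlane_of_im_ne_zero hm.1.ne')) (by positivity) _
    fun _ ht => exp_mul_csqrt_of_mem_triangle h0 h1 hm ht

theorem period_one_sub_mem_quadrant {φ : ℝ} (h0 : 0 < φ) (h1 : φ < Real.pi / 2) {m : ℂ}
    (hm : m ∈ triangle φ) : 0 < ((exp (I * (φ / 2 : ℝ)))⁻¹ * period (1 - m)).re ∧
      ((exp (I * (φ / 2 : ℝ)))⁻¹ * period (1 - m)).im < 0 :=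
  integral_div_mem_quadrant (continuous_period_integrand
    (by rw [sub_sub_cancel]; exact Or.inr hm.1.ne')) (by positivity) _
    fun _ ht => exp_mul_csqrt_one_sub_of_mem_triangle h0 h1 hm ht

/-- The linearized equations have only the trivial solution. -/
theorem eq_zero_of_quadrant {φ : ℝ} {E K L d : ℂ} (hK : 0 < (E * K).re ∧ (E * K).im < 0)
    (hL : 0 < (E * L).re ∧ (E * L).im < 0)
    (h0 : (exp (I * φ) * (d * K)).re = 0) (h1 : (exp (I * φ) * (d * L)).im = 0) : d = 0 := by
  have hpos : 0 < (E * K * starRingEnd ℂ (E * L)).re := by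
    rw [mul_re, conj_re, conj_im]
    have := mul_pos hK.1 hL.1
    have := mul_pos_of_neg_of_neg hK.2 hL.2
    linarith
  have hzero : (exp (I * φ) * (d * K) * starRingEnd ℂ (exp (I * φ) * (d * L))).re = 0 := by
    rw [mul_re, conj_re, conj_im, h0, h1]; ring
  have e1 : E * K * starRingEnd ℂ (E * L) = (normSq E : ℂ) * (K * starRingEnd ℂ L) := by
    rw [← mul_conj, map_mul]; ring
  have e2 : exp (I * φ) * (d * K) * starRingEnd ℂ (exp (I * φ) * (d * L)) =
      ((normSq (exp (I * φ)) * normSq d : ℝ) : ℂ) * (K * starRingEnd ℂ L) := by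
    push_cast
    rw [← mul_conj, ← mul_conj, map_mul, map_mul]; ring
  rw [e1, re_ofReal_mul] at hpos
  rw [e2, re_ofReal_mul, mul_eq_zero, mul_eq_zero] at hzero
  rcases hzero with (h | h) | h
  · exact absurd (normSq_eq_zero.1 h) (exp_ne_zero _)
  · exact normSq_eq_zero.1 h
  · rw [h, mul_zero] at hpos; exact absurd hpos (lt_irrefl _)

theorem continuousOn_period : ContinuousOn period {m : ℂ | 1 - m ∈ slitPlane} := by
  have : DifferentiableOn ℂ action {m : ℂ | 1 - m ∈ slitPlane} := fun m hm =>
    (hasDerivAt_action hm).differentiableAt.differentiableWithinAt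
  exact (this.deriv isOpen_one_sub_mem_slitPlane).continuousOn.congr fun m hm =>
    (hasDerivAt_action hm).deriv.symm

/-- Uniqueness of the solution in the triangle. -/
theorem eq_of_mem_triangle {φ : ℝ} (h0 : 0 < φ) (h1 : φ < Real.pi / 2) {z w : ℂ}
    (hz : z ∈ triangle φ) (hw : w ∈ triangle φ)
    (hz0 : (exp (I * φ) * action z).re = 0) (hz1 : (exp (I * φ) * action (1 - z)).im = 0)
    (hw0 : (exp (I * φ) * action w).re = 0) (hw1 : (exp (I * φ) * action (1 - w)).im = 0) :
    z = w := by
  set d := w - z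
  let γ : ℝ → ℂ := fun r => z + r * d
  have hγ : ∀ r ∈ Icc (0 : ℝ) 1, γ r ∈ triangle φ := fun r hr => by
    have := (convex_triangle φ).add_smul_sub_mem hz hw hr
    simpa [γ, d] using this
  have hγd : ∀ r, HasDerivAt γ d r := fun r =>
    ((((hasDerivAt_id' r).ofReal_comp).mul_const d).const_add z).congr_deriv (by simp)
  have hγc : Continuous γ := by fun_prop
  have hm1 : ∀ r ∈ Icc (0 : ℝ) 1, 1 - γ r ∈ slitPlane := fun r hr =>
    one_sub_mem_slitPlane_of_im_ne_zero (hγ r hr).1.ne'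
  have hm2 : ∀ r ∈ Icc (0 : ℝ) 1, 1 - (1 - γ r) ∈ slitPlane := fun r hr => by
    rw [sub_sub_cancel]; exact Or.inr (hγ r hr).1.ne'
  have hc1 : ContinuousOn (fun r => period (γ r)) (Icc 0 1) :=
    continuousOn_period.comp hγc.continuousOn hm1
  have hc2 : ContinuousOn (fun r => period (1 - γ r)) (Icc 0 1) :=
    continuousOn_period.comp (continuous_const.sub hγc).continuousOn hm2
  have hi1 := hc1.intervalIntegrable_of_Icc (μ := volume) zero_le_one
  have hi2 := hc2.intervalIntegrable_of_Icc (μ := volume) zero_le_one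
  have ftc1 := integral_eq_sub_of_hasDerivAt (a := 0) (b := 1) (f := fun r => action (γ r))
    (f' := fun r => d * period (γ r))
    (fun r hr => by
      rw [uIcc_of_le zero_le_one] at hr
      exact ((hasDerivAt_action (hm1 r hr)).comp r (hγd r)).congr_deriv (mul_comm _ _))
    (hi1.const_mul d)
  have ftc2 := integral_eq_sub_of_hasDerivAt (a := 0) (b := 1) (f := fun r => -action (1 - γ r))
    (f' := fun r => d * period (1 - γ r))
    (fun r hr => by
      rw [uIcc_of_le zero_le_one] at hr
      refine ((hasDerivAt_action (hm2 r hr)).comp r ((hγd r).const_sub 1)).neg.congr_deriv ?_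
      ring)
    (hi2.const_mul d)
  rw [intervalIntegral.integral_const_mul] at ftc1 ftc2
  have g0 : γ 0 = z := by simp [γ]
  have g1 : γ 1 = w := by simp [γ, d]
  rw [g0, g1] at ftc1 ftc2
  -- The open quadrant is a convex cone, so the averages of the two periods over the segment stay in
  -- it.
  have hq : ∀ G : ℝ → ℂ, IntervalIntegrable G volume 0 1 →
      (∀ r ∈ Icc (0 : ℝ) 1, 0 < ((exp (I * (φ / 2 : ℝ)))⁻¹ * G r).re ∧
        ((exp (I * (φ / 2 : ℝ)))⁻¹ * G r).im < 0) →
      0 < ((exp (I * (φ / 2 : ℝ)))⁻¹ * ∫ r in (0 : ℝ)..1, G r).re ∧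
        ((exp (I * (φ / 2 : ℝ)))⁻¹ * ∫ r in (0 : ℝ)..1, G r).im < 0 := fun G hG h => by
    constructor
    · have := im_mul_integral_pos_of_intervalIntegrable hG zero_lt_one
        (I * (exp (I * (φ / 2 : ℝ)))⁻¹) fun t ht => by
          rw [mul_assoc, I_mul_im]; exact (h t (Ioo_subset_Icc_self ht)).1
      rwa [mul_assoc, I_mul_im] at this
    · have := im_mul_integral_pos_of_intervalIntegrable hG zero_lt_one
        (-(exp (I * (φ / 2 : ℝ)))⁻¹) fun t ht => by
          rw [neg_mul, neg_im]; exact neg_pos.2 (h t (Ioo_subset_Icc_self ht)).2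
      rw [neg_mul, neg_im] at this
      exact neg_pos.1 this
  have hd : d = 0 := by
    refine eq_zero_of_quadrant (φ := φ)
      (hq _ hi1 fun r hr => period_mem_quadrant h0 h1 (hγ r hr))
      (hq _ hi2 fun r hr => period_one_sub_mem_quadrant h0 h1 (hγ r hr)) ?_ ?_
    · rw [ftc1, mul_sub, sub_re, hz0, hw0, sub_zero]
    · rw [ftc2, mul_sub, mul_neg, mul_neg, sub_im, neg_im, neg_im, hz1, hw1, neg_zero, sub_zero]
  exact (sub_eq_zero.1 hd).symm

/-! ### The solution set and its smooth branches -/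

/-- The two real equations for the basic periods. -/
def IsSol (φ : ℝ) (m : ℂ) : Prop :=
  (exp (I * φ) * action m).re = 0 ∧ (exp (I * φ) * action (1 - m)).im = 0

/-- The closed upper half of the disc with diameter `[0, 1]`. -/
def halfDisc : Set ℂ := {m | normSq m ≤ m.re ∧ 0 ≤ m.im}

theorem IsSol.mem_triangle {φ : ℝ} {m : ℂ} (h : IsSol φ m) (hm : 0 < m.im)
    (hφ : φ ∈ Icc 0 (Real.pi / 2)) : 0 < φ ∧ φ < Real.pi / 2 ∧ m ∈ triangle φ := by
  have hp := Real.pi_pos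
  obtain ⟨θ, k, hk, h0, h1, h2, h3⟩ := exists_angle hm h.1 h.2
  have hk0 : k = 0 := by
    have b1 : (-1 : ℝ) < k := by
      by_contra hcon
      have := hφ.1
      nlinarith
    have b2 : (k : ℝ) < 1 := by
      by_contra hcon
      have := hφ.2
      nlinarith
    have b1' : -1 < k := by exact_mod_cast b1
    have b2' : k < 1 := by exact_mod_cast b2
    omega
  have hθ : φ = θ := by rw [hk, hk0]; simp
  subst hθ
  have hα := arg_pos_of_im_pos hm
  have hβ : (1 - m).arg < 0 := arg_neg_iff.2 (by simpa using hm)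
  have polar : ∀ z : ℂ, exp (I * φ) * z = (‖z‖ : ℂ) * exp ((φ + z.arg : ℝ) * I) := fun z => by
    conv_lhs => rw [← norm_mul_exp_arg_mul_I z]
    push_cast
    rw [add_mul, exp_add, mul_comm I]
    ring
  have hm0 := ne_zero_of_im_ne_zero hm.ne'
  have hm1 := one_sub_ne_zero_of_im_ne_zero hm.ne'
  refine ⟨h0, h1, hm, ?_, ?_⟩
  · rw [polar, re_ofReal_mul, exp_ofReal_mul_I_re]
    exact mul_pos (norm_pos_iff.2 hm0) (Real.cos_pos_of_mem_Ioo ⟨by linarith, by linarith⟩)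
  · rw [polar, im_ofReal_mul, exp_ofReal_mul_I_im]
    exact mul_pos (norm_pos_iff.2 hm1) (Real.sin_pos_of_pos_of_lt_pi (by linarith) (by linarith))

/-- By Thales: the right-angled vertex lies on the circle with diameter [0, 1]. Multiplying the
inequalities sin φ · Im m < cos φ · Re m and cos φ · Im m < sin φ · (1 - Re m) gives the claim. -/
theorem normSq_lt_of_mem_triangle {φ : ℝ} (h0 : 0 < φ) (h1 : φ < Real.pi / 2) {m : ℂ}
    (hm : m ∈ triangle φ) : normSq m < m.re := by
  have hp := Real.pi_pos
  have hs := Real.sin_pos_of_pos_of_lt_pi (x := φ) h0 (by linarith)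
  have hc := Real.cos_pos_of_mem_Ioo (x := φ) ⟨by linarith, h1⟩
  obtain ⟨h2, h3, h4⟩ := hm
  rw [exp_mul_re] at h3
  rw [exp_mul_im] at h4
  simp only [sub_re, sub_im, one_re, one_im] at h4
  have key : (Real.sin φ * m.im) * (Real.cos φ * m.im) <
      (Real.cos φ * m.re) * (Real.sin φ * (1 - m.re)) :=
    mul_lt_mul'' (by linarith) (by linarith) (by positivity) (by positivity)
  rw [normSq_apply]
  have hsc := mul_pos hs hc
  by_contra hcon
  have := mul_le_mul_of_nonneg_left (not_lt.1 hcon) hsc.le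
  linarith

/-- The pair of real equations as a single complex function. -/
def solMap (p : ℝ × ℂ) : ℂ :=
  ((exp (I * p.1) * action p.2).re : ℂ) + (exp (I * p.1) * action (1 - p.2)).im * I

theorem solMap_eq_zero_iff {φ : ℝ} {m : ℂ} : solMap (φ, m) = 0 ↔ IsSol φ m := by
  rw [solMap, IsSol, Complex.ext_iff]
  simp

theorem contDiffAt_solMap {φ : ℝ} {m : ℂ} (hm : m.im ≠ 0) : ContDiffAt ℝ ∞ solMap (φ, m) := by
  have he : ContDiffAt ℝ ∞ (fun p : ℝ × ℂ => exp (I * p.1)) (φ, m) :=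
    (contDiffAt_const.mul (ofRealCLM.contDiff.contDiffAt.comp _ contDiffAt_fst)).cexp
  have h1 : ContDiffAt ℝ ∞ (fun p : ℝ × ℂ => action p.2) (φ, m) :=
    ContDiffAt.comp (g := action) (φ, m) ((contDiffAt_action
      (one_sub_mem_slitPlane_of_im_ne_zero hm)).restrict_scalars ℝ) contDiffAt_snd
  have h2 : ContDiffAt ℝ ∞ (fun p : ℝ × ℂ => action (1 - p.2)) (φ, m) :=
    ContDiffAt.comp (g := action) (φ, m) ((contDiffAt_action (m := 1 - m)
      (by rw [sub_sub_cancel]; exact Or.inr hm)).restrict_scalars ℝ)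
      (contDiffAt_const.sub contDiffAt_snd)
  refine ContDiffAt.add (ofRealCLM.contDiff.contDiffAt.comp _
    (reCLM.contDiff.contDiffAt.comp _ (he.mul h1))) (ContDiffAt.mul
      (ofRealCLM.contDiff.contDiffAt.comp _ (imCLM.contDiff.contDiffAt.comp _ (he.mul h2)))
      contDiffAt_const)

/-- The smooth local branch of solutions. -/
theorem IsSol.exists_branch {φ : ℝ} (h0 : 0 < φ) (h1 : φ < Real.pi / 2) {m : ℂ}
    (hm : m ∈ triangle φ) (h : IsSol φ m) :
    ∃ ψ : ℝ → ℂ, ContDiffAt ℝ ∞ ψ φ ∧ ∀ᶠ x in 𝓝 φ, IsSol x (ψ x) ∧ 0 < (ψ x).im := by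
  have hcd := contDiffAt_solMap (φ := φ) hm.1.ne'
  -- In the direction d the derivative has components Re(e^{iφ} d `period m`) and -Im(e^{iφ} d
  -- `period (1 - m)`), so the quadrant argument makes its kernel trivial.
  have hinj : ∀ d, (fderiv ℝ solMap (φ, m) ∘L .inr ℝ ℝ ℂ) d = 0 → d = 0 := fun d hd => by
    have hc : HasDerivAt (fun r : ℝ => ((φ, m + r * d) : ℝ × ℂ)) (0, d) 0 :=
      (hasDerivAt_const _ _).prodMk
        (((((hasDerivAt_id' (0 : ℝ)).ofReal_comp).mul_const d).const_add m).congr_deriv (by simp))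
    have hc0 : (fun r : ℝ => ((φ, m + r * d) : ℝ × ℂ)) 0 = (φ, m) := by simp
    have hF : HasFDerivAt solMap (fderiv ℝ solMap (φ, m))
        ((fun r : ℝ => ((φ, m + r * d) : ℝ × ℂ)) 0) := by
      rw [hc0]; exact (hcd.differentiableAt (by simp)).hasFDerivAt
    have e1 := hF.comp_hasDerivAt 0 hc
    have e1' : fderiv ℝ solMap (φ, m) (0, d) = 0 := hd
    rw [e1'] at e1
    have hd1 : HasDerivAt (fun r : ℝ => m + r * d) d 0 :=
      ((((hasDerivAt_id' (0 : ℝ)).ofReal_comp).mul_const d).const_add m).congr_deriv (by simp)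
    have ha1 : HasDerivAt (fun r : ℝ => action (m + r * d)) (period m * d) 0 := by
      refine HasDerivAt.comp (h₂ := action) 0 ?_ hd1
      simpa using hasDerivAt_action (one_sub_mem_slitPlane_of_im_ne_zero hm.1.ne')
    have ha2 : HasDerivAt (fun r : ℝ => action (1 - (m + r * d))) (period (1 - m) * -d) 0 := by
      refine HasDerivAt.comp (h₂ := action) 0 ?_ (hd1.const_sub 1)
      simpa using hasDerivAt_action (m := 1 - m) (by rw [sub_sub_cancel]; exact Or.inr hm.1.ne')
    have b1 := reCLM.hasFDerivAt.comp_hasDerivAt 0 (ha1.const_mul (exp (I * φ)))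
    have b2 := imCLM.hasFDerivAt.comp_hasDerivAt 0 (ha2.const_mul (exp (I * φ)))
    have c1 := reCLM.hasFDerivAt.comp_hasDerivAt 0 e1
    have c2 := imCLM.hasFDerivAt.comp_hasDerivAt 0 e1
    have f1 : ⇑reCLM ∘ (solMap ∘ fun r : ℝ => ((φ, m + r * d) : ℝ × ℂ)) =
        ⇑reCLM ∘ fun r : ℝ => exp (I * φ) * action (m + r * d) := by
      funext r; simp [solMap]
    have f2 : ⇑imCLM ∘ (solMap ∘ fun r : ℝ => ((φ, m + r * d) : ℝ × ℂ)) =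
        ⇑imCLM ∘ fun r : ℝ => exp (I * φ) * action (1 - (m + r * d)) := by
      funext r; simp [solMap]
    rw [f1] at c1
    rw [f2] at c2
    have g1 := b1.unique c1
    have g2 := b2.unique c2
    refine eq_zero_of_quadrant (φ := φ) (period_mem_quadrant h0 h1 hm)
      (period_one_sub_mem_quadrant h0 h1 hm) ?_ ?_
    · rw [mul_comm d]; simpa using g1
    · rw [mul_neg, mul_neg, map_neg, map_zero, neg_eq_zero] at g2
      rw [mul_comm d]; simpa using g2
  have hinv : (fderiv ℝ solMap (φ, m) ∘L .inr ℝ ℝ ℂ).IsInvertible := by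
    have hker : Function.Injective (fderiv ℝ solMap (φ, m) ∘L .inr ℝ ℝ ℂ : ℂ →L[ℝ] ℂ).toLinearMap :=
      (injective_iff_map_eq_zero _).2 hinj
    refine ⟨(LinearEquiv.ofInjectiveEndo _ hker).toContinuousLinearEquiv, ?_⟩
    ext x; rfl
  have hn : (∞ : WithTop ℕ∞) ≠ 0 := by simp
  have hval := hcd.implicitFunction_apply_self hn hinv
  have hsm := hcd.contDiffAt_implicitFunction hn hinv
  refine ⟨hcd.implicitFunction hn hinv, hsm, ?_⟩
  have hpos : ∀ᶠ x in 𝓝 φ, 0 < (hcd.implicitFunction hn hinv x).im := by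
    have : ContinuousAt (fun x => (hcd.implicitFunction hn hinv x).im) φ :=
      continuous_im.continuousAt.comp hsm.continuousAt
    refine this.eventually (lt_mem_nhds ?_)
    have e : hcd.implicitFunction hn hinv φ = m := hval
    beta_reduce
    rw [e]; exact hm.1
  filter_upwards [hcd.eventually_apply_implicitFunction hn hinv, hpos] with x hx hx2
  exact ⟨solMap_eq_zero_iff.1 (hx.trans (solMap_eq_zero_iff.2 h)), hx2⟩

/-! ### Closedness and uniqueness in the half-disc -/

theorem isClosed_halfDisc : IsClosed halfDisc :=
  (isClosed_le continuous_normSq continuous_re).inter (isClosed_le continuous_const continuous_im)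

theorem re_mem_Icc_of_normSq_le {m : ℂ} (h : normSq m ≤ m.re) : 0 ≤ m.re ∧ m.re ≤ 1 := by
  have h0 : 0 ≤ m.re := (normSq_nonneg m).trans h
  refine ⟨h0, ?_⟩
  rw [normSq_apply] at h
  nlinarith [mul_self_nonneg m.im]

theorem norm_le_one_of_normSq_le {m : ℂ} (h : normSq m ≤ m.re) : ‖m‖ ≤ 1 := by
  have := (re_mem_Icc_of_normSq_le h).2
  rw [normSq_eq_norm_sq] at h
  nlinarith [norm_nonneg m]

theorem isCompact_halfDisc : IsCompact halfDisc :=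
  (isCompact_closedBall (0 : ℂ) 1).of_isClosed_subset isClosed_halfDisc fun m hm => by
    rw [mem_closedBall_zero_iff]
    exact norm_le_one_of_normSq_le hm.1

/-- Dominated convergence reaches the endpoint m = 1: on the disc Re m ≤ 1, so the root has modulus
at least |cos t|, and one factor of cos² t cancels it, leaving the bound 8. -/
theorem continuousOn_action : ContinuousOn action {m | normSq m ≤ m.re} := by
  intro m hm
  have hre : ∀ m ∈ {m : ℂ | normSq m ≤ m.re}, ∀ t : ℝ,
      Real.cos t ^ 2 ≤ (1 - m * (Real.sin t : ℂ) ^ 2).re := fun m hm t => by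
    have := (re_mem_Icc_of_normSq_le hm).2
    rw [← ofReal_pow, sub_re, re_mul_ofReal, one_re, Real.cos_sq']
    nlinarith [sq_nonneg (Real.sin t)]
  refine intervalIntegral.continuousWithinAt_of_dominated_interval (bound := fun _ => 8) ?_ ?_
    intervalIntegrable_const ?_
  · refine Eventually.of_forall fun m => Measurable.aestronglyMeasurable ?_
    unfold Complex.sqrt
    exact Measurable.div (by fun_prop) (Measurable.pow_const (by fun_prop) _)
  · filter_upwards [self_mem_nhdsWithin] with m hm
    refine ae_of_all _ fun t _ => ?_
    have h1 := norm_le_one_of_normSq_le hm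
    have h2 : |Real.cos t| ≤ √‖1 - m * (Real.sin t : ℂ) ^ 2‖ := by
      refine Real.le_sqrt_of_sq_le ?_
      rw [sq_abs]
      exact (hre m hm t).trans (re_le_norm _)
    rw [norm_div, norm_csqrt, norm_mul, norm_mul, norm_pow, norm_real, Real.norm_eq_abs]
    refine div_le_of_le_mul₀ (Real.sqrt_nonneg _) (by norm_num) ?_
    have h3 := Real.abs_cos_le_one t
    have h4 := abs_nonneg (Real.cos t)
    have h5 : ‖(8 : ℂ)‖ = 8 := by norm_num
    rw [h5]
    have h6 : |Real.cos t| ^ 2 ≤ |Real.cos t| := by nlinarith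
    have h7 : 8 * ‖m‖ * |Real.cos t| ^ 2 ≤ 8 * 1 * |Real.cos t| :=
      mul_le_mul (by linarith) h6 (by positivity) (by positivity)
    linarith
  · refine ae_of_all _ fun t _ => ?_
    rcases eq_or_ne (Real.cos t) 0 with hc | hc
    · simp only [hc, ofReal_zero, ne_eq, OfNat.ofNat_ne_zero, not_false_eq_true, zero_pow, mul_zero,
        zero_div]
      exact continuousWithinAt_const
    · have hs : 1 - m * (Real.sin t : ℂ) ^ 2 ∈ slitPlane :=
        Or.inl (lt_of_lt_of_le (by positivity) (hre m hm t))
      refine ContinuousAt.continuousWithinAt (ContinuousAt.div (by fun_prop) ?_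
        (csqrt_ne_zero (slitPlane_ne_zero hs)))
      exact ContinuousAt.comp (g := Complex.sqrt)
        (f := fun m : ℂ => 1 - m * (Real.sin t : ℂ) ^ 2) (continuousAt_csqrt hs) (by fun_prop)

theorem normSq_one_sub_le {m : ℂ} (h : normSq m ≤ m.re) : normSq (1 - m) ≤ (1 - m).re := by
  simp only [normSq_apply, sub_re, one_re, sub_im, one_im] at h ⊢
  nlinarith

theorem isClosed_isSol : IsClosed {p : ℝ × ℂ | p.2 ∈ halfDisc ∧ IsSol p.1 p.2} := by
  have hD : IsClosed {p : ℝ × ℂ | p.2 ∈ halfDisc} := isClosed_halfDisc.preimage continuous_snd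
  have he : ContinuousOn (fun p : ℝ × ℂ => exp (I * p.1)) {p | p.2 ∈ halfDisc} := by fun_prop
  have h1 : ContinuousOn (fun p : ℝ × ℂ => action p.2) {p | p.2 ∈ halfDisc} :=
    continuousOn_action.comp continuousOn_snd fun p hp => hp.1
  have h2 : ContinuousOn (fun p : ℝ × ℂ => action (1 - p.2)) {p | p.2 ∈ halfDisc} :=
    continuousOn_action.comp (by fun_prop) fun p hp => normSq_one_sub_le hp.1
  have h3 : ContinuousOn solMap {p | p.2 ∈ halfDisc} := by
    refine ContinuousOn.add ?_ (ContinuousOn.mul ?_ continuousOn_const)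
    · exact continuous_ofReal.comp_continuousOn (continuous_re.comp_continuousOn (he.mul h1))
    · exact continuous_ofReal.comp_continuousOn (continuous_im.comp_continuousOn (he.mul h2))
  have := h3.preimage_isClosed_of_isClosed hD (isClosed_singleton (x := (0 : ℂ)))
  convert this using 1
  ext p
  simp only [mem_ofPred_eq, mem_inter_iff, mem_preimage, mem_singleton_iff]
  rw [← solMap_eq_zero_iff]

/-- Strictly between 0 and 1 both actions are positive reals, which would force sin φ = cos φ = 0.
At the ends one action is 0 and the other 8. -/
theorem IsSol.eq_of_im_eq_zero {φ : ℝ} {m : ℂ} (h : IsSol φ m) (hm : m ∈ halfDisc)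
    (him : m.im = 0) : (m = 0 ∧ Real.sin φ = 0) ∨ (m = 1 ∧ Real.cos φ = 0) := by
  obtain ⟨h0, h1⟩ := re_mem_Icc_of_normSq_le hm.1
  have hx : m = (m.re : ℂ) := Complex.ext rfl (by simpa using him)
  generalize m.re = x at *
  subst hx
  obtain ⟨e1, e2⟩ := h
  rw [exp_mul_re] at e1
  rw [exp_mul_im] at e2
  rcases h0.eq_or_lt with rfl | h0
  · left
    simp only [ofReal_zero, sub_zero, action_one] at e2
    simpa using e2
  rcases h1.eq_or_lt with rfl | h1
  · right
    simp only [ofReal_one, action_one] at e1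
    simpa using e1
  · exfalso
    obtain ⟨r, hr, er⟩ := exists_action_ofReal h1
    obtain ⟨s, hs, es⟩ := exists_action_ofReal (m := 1 - x) (by linarith)
    rw [er, ofReal_re, ofReal_im] at e1
    push_cast at es
    rw [es, ← ofReal_one, ← ofReal_sub, ← ofReal_mul, ofReal_re, ofReal_im] at e2
    have e1' : Real.cos φ = 0 := by
      have := mul_pos h0 hr
      have h3 : Real.cos φ * (x * r) = 0 := by linarith
      exact (mul_eq_zero.1 h3).resolve_right this.ne'
    have e2' : Real.sin φ = 0 := by
      have := mul_pos (sub_pos.2 h1) hs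
      have h3 : Real.sin φ * ((1 - x) * s) = 0 := by linarith
      exact (mul_eq_zero.1 h3).resolve_right this.ne'
    have := Real.sin_sq_add_cos_sq φ
    rw [e1', e2'] at this
    norm_num at this

theorem IsSol.mem_triangle_of_mem_Ioo {φ : ℝ} {m : ℂ} (h : IsSol φ m) (hm : m ∈ halfDisc)
    (hφ : φ ∈ Ioo 0 (Real.pi / 2)) : m ∈ triangle φ := by
  rcases hm.2.eq_or_lt with him | him
  · have hs := Real.sin_pos_of_pos_of_lt_pi (x := φ) hφ.1 (by linarith [hφ.2, Real.pi_pos])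
    have hc := Real.cos_pos_of_mem_Ioo (x := φ) ⟨by linarith [hφ.1, Real.pi_pos], hφ.2⟩
    rcases h.eq_of_im_eq_zero hm him.symm with h | h
    · exact absurd h.2 hs.ne'
    · exact absurd h.2 hc.ne'
  · exact (h.mem_triangle him ⟨hφ.1.le, hφ.2.le⟩).2.2

theorem mem_halfDisc_of_mem_triangle {φ : ℝ} (hφ : φ ∈ Ioo 0 (Real.pi / 2)) {m : ℂ}
    (hm : m ∈ triangle φ) : m ∈ halfDisc :=
  ⟨(normSq_lt_of_mem_triangle hφ.1 hφ.2 hm).le, hm.1.le⟩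

theorem IsSol.eq {φ : ℝ} (hφ : φ ∈ Icc 0 (Real.pi / 2)) {z w : ℂ} (hz : IsSol φ z)
    (hw : IsSol φ w) (hzD : z ∈ halfDisc) (hwD : w ∈ halfDisc) : z = w := by
  by_cases h : φ ∈ Ioo 0 (Real.pi / 2)
  · exact eq_of_mem_triangle h.1 h.2 (hz.mem_triangle_of_mem_Ioo hzD h)
      (hw.mem_triangle_of_mem_Ioo hwD h) hz.1 hz.2 hw.1 hw.2
  · have him : ∀ z, IsSol φ z → z ∈ halfDisc → z.im = 0 := fun z hz hzD => by
      by_contra hne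
      have := hz.mem_triangle (lt_of_le_of_ne hzD.2 (Ne.symm hne)) hφ
      exact h ⟨this.1, this.2.1⟩
    have hsc := Real.sin_sq_add_cos_sq φ
    rcases hz.eq_of_im_eq_zero hzD (him z hz hzD) with h1 | h1 <;>
    rcases hw.eq_of_im_eq_zero hwD (him w hw hwD) with h2 | h2
    · rw [h1.1, h2.1]
    · rw [h1.2, h2.2] at hsc; norm_num at hsc
    · rw [h1.2, h2.2] at hsc; norm_num at hsc
    · rw [h1.1, h2.1]

/-! ### Existence by continuation, and continuity -/

/-- On the symmetry axis the two equations coincide. -/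
theorem exists_isSol_pi_div_four :
    ∃ m ∈ triangle (Real.pi / 4), IsSol (Real.pi / 4) m := by
  have hp := Real.pi_pos
  let γ : ℝ → ℂ := fun r => 1 / 2 + r * I
  have hγre : ∀ r, (γ r).re = 1 / 2 := fun r => by simp [γ]
  have hγim : ∀ r, (γ r).im = r := fun r => by simp [γ]
  have hD : ∀ r ∈ Icc (0 : ℝ) (1 / 2), γ r ∈ halfDisc := fun r hr => by
    refine ⟨?_, by rw [hγim]; exact hr.1⟩
    rw [normSq_apply, hγre, hγim]
    nlinarith [hr.1, hr.2]
  have hcont : ContinuousOn (fun r => (action (γ r)).re - (action (γ r)).im) (Icc 0 (1 / 2)) := by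
    have : ContinuousOn (fun r => action (γ r)) (Icc 0 (1 / 2)) :=
      continuousOn_action.comp (by fun_prop) fun r hr => (hD r hr).1
    exact (continuous_re.comp_continuousOn this).sub (continuous_im.comp_continuousOn this)
  have h0 : 0 < (action (γ 0)).re - (action (γ 0)).im := by
    obtain ⟨r, hr, e⟩ := exists_action_ofReal (m := 1 / 2) (by norm_num)
    have : γ 0 = ((1 / 2 : ℝ) : ℂ) := by simp [γ]
    rw [this, e, ofReal_re, ofReal_im]
    linarith
  -- At m = (1 + i)/2, Re - Im of 8m `actionMean m` equals -8 Im `actionMean m`.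
  have h1 : (action (γ (1 / 2))).re - (action (γ (1 / 2))).im < 0 := by
    have := actionMean_im_pos (m := γ (1 / 2)) (by rw [hγim]; norm_num)
    rw [action_eq_actionMean, mul_assoc, ← ofReal_ofNat, re_ofReal_mul, im_ofReal_mul, mul_re,
      mul_im, hγre, hγim]
    linarith
  obtain ⟨r, hr, e⟩ := intermediate_value_Icc' (by norm_num : (0 : ℝ) ≤ 1 / 2) hcont
    ⟨h1.le, h0.le⟩
  simp only at e
  have hsol : IsSol (Real.pi / 4) (γ r) := by
    have hcs : Real.cos (Real.pi / 4) = Real.sin (Real.pi / 4) := by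
      rw [Real.cos_pi_div_four, Real.sin_pi_div_four]
    have hconj : 1 - γ r = starRingEnd ℂ (γ r) := by
      apply Complex.ext
      · rw [sub_re, conj_re, hγre, one_re]; norm_num
      · simp
    constructor
    · rw [exp_mul_re, hcs, ← mul_sub, e, mul_zero]
    · have hs : 1 - γ r ∈ slitPlane := Or.inl (by rw [sub_re, hγre, one_re]; norm_num)
      rw [exp_mul_im, hconj, action_conj hs, conj_re, conj_im, hcs]
      linear_combination Real.sin (Real.pi / 4) * e
  exact ⟨_, hsol.mem_triangle_of_mem_Ioo (hD r hr) ⟨by linarith, by linarith⟩, hsol⟩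

/-- Openness comes from the smooth branch, relative closedness from compactness of the half-disc: a
limit of solutions at an interior angle cannot be real, so it lies in the triangle again. -/
theorem exists_isSol {φ : ℝ} (hφ : φ ∈ Ioo 0 (Real.pi / 2)) : ∃ m ∈ triangle φ, IsSol φ m := by
  let S : Set ℝ := {φ | φ ∈ Ioo 0 (Real.pi / 2) ∧ ∃ m ∈ triangle φ, IsSol φ m}
  have hopen : IsOpen S := by
    rw [isOpen_iff_mem_nhds]
    rintro x ⟨hx, m, hm, hs⟩
    obtain ⟨ψ, -, hψ⟩ := hs.exists_branch hx.1 hx.2 hm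
    filter_upwards [hψ, isOpen_Ioo.mem_nhds hx] with y hy hy2
    exact ⟨hy2, _, (hy.1.mem_triangle hy.2 ⟨hy2.1.le, hy2.2.le⟩).2.2, hy.1⟩
  have hclosed : closure S ∩ Ioo 0 (Real.pi / 2) ⊆ S := by
    rintro x ⟨hx, hx2⟩
    obtain ⟨u, hu, hlim⟩ := mem_closure_iff_seq_limit.1 hx
    choose hu1 m hm hs using hu
    obtain ⟨z, hz, n, hn, hlimz⟩ := isCompact_halfDisc.tendsto_subseq
      fun k => mem_halfDisc_of_mem_triangle (hu1 k) (hm k)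
    have := isClosed_isSol.mem_of_tendsto ((hlim.comp hn.tendsto_atTop).prodMk_nhds hlimz)
      (Eventually.of_forall fun k => ⟨mem_halfDisc_of_mem_triangle (hu1 _) (hm _), hs _⟩)
    exact ⟨hx2, z, IsSol.mem_triangle_of_mem_Ioo this.2 hz hx2, this.2⟩
  have hp := Real.pi_pos
  refine (isPreconnected_Ioo.subset_of_closure_inter_subset hopen ?_ hclosed hφ).2
  exact ⟨Real.pi / 4, ⟨by linarith, by linarith⟩, ⟨by linarith, by linarith⟩,
    exists_isSol_pi_div_four⟩

theorem isSol_zero : IsSol 0 0 := by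
  constructor <;> simp [action_zero, action_one]

theorem isSol_pi_div_two : IsSol (Real.pi / 2) 1 := by
  constructor
  · rw [exp_mul_re, action_one]; simp
  · simp [action_zero]

theorem exists_isSol_of_mem_Icc {φ : ℝ} (hφ : φ ∈ Icc 0 (Real.pi / 2)) :
    ∃ m ∈ halfDisc, IsSol φ m := by
  rcases hφ.1.eq_or_lt with h | h
  · exact ⟨0, by simp [halfDisc], h ▸ isSol_zero⟩
  rcases hφ.2.eq_or_lt with h2 | h2
  · exact ⟨1, by simp [halfDisc], h2 ▸ isSol_pi_div_two⟩
  · obtain ⟨m, hm, hs⟩ := exists_isSol ⟨h, h2⟩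
    exact ⟨m, mem_halfDisc_of_mem_triangle ⟨h, h2⟩ hm, hs⟩

/-- The solutions depend continuously on the angle. -/
theorem continuousOn_of_isSol {M : ℝ → ℂ}
    (hM : ∀ φ ∈ Icc 0 (Real.pi / 2), M φ ∈ halfDisc ∧ IsSol φ (M φ)) :
    ContinuousOn M (Icc 0 (Real.pi / 2)) := by
  intro φ hφ
  refine isCompact_halfDisc.tendsto_nhds_of_unique_mapClusterPt ?_ fun z hz hcl => ?_
  · filter_upwards [self_mem_nhdsWithin] with x hx using (hM x hx).1
  · obtain ⟨U, hU, hlim⟩ := mapClusterPt_iff_ultrafilter.1 hcl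
    have h1 : Tendsto (fun x => (x, M x)) U (𝓝 (φ, z)) :=
      Tendsto.prodMk_nhds (tendsto_id.mono_left (hU.trans nhdsWithin_le_nhds)) hlim
    have := isClosed_isSol.mem_of_tendsto h1 (hU (by
      filter_upwards [self_mem_nhdsWithin] with x hx using hM x hx))
    exact IsSol.eq hφ this.2 (hM φ hφ).2 hz (hM φ hφ).1

/-! ### A loop through the nodes -/

theorem hasDerivAt_mul_abs_self (x : ℝ) : HasDerivAt (fun x : ℝ => x * |x|) (2 * |x|) x := by
  have hne : ∀ y : ℝ, y ≠ 0 → HasDerivAt (fun x : ℝ => x * |x|) (2 * |y|) y := fun y hy => by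
    refine ((hasDerivAt_id' y).mul (hasDerivAt_abs hy)).congr_deriv ?_
    rw [self_mul_sign]
    ring
  rcases eq_or_ne x 0 with rfl | hx
  · exact hasDerivAt_of_hasDerivAt_of_ne (g := fun y => 2 * |y|) hne (by fun_prop) (by fun_prop)
  · exact hne x hx

theorem contDiff_mul_abs_self : ContDiff ℝ 1 (fun x : ℝ => x * |x|) := by
  refine contDiff_one_iff_deriv.2 ⟨fun x => (hasDerivAt_mul_abs_self x).differentiableAt, ?_⟩
  rw [funext fun x => (hasDerivAt_mul_abs_self x).deriv]
  fun_prop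

/-- A loop on the nodal curve that changes sheets at the two nodes has period `-8`. -/
theorem exists_nodal_cycle : ∃ c : Cycle 2, c.integral = -8 := by
  have hp := Real.pi_pos
  -- An arc from 1 to -1 avoiding 0, traversed back and forth. As λ² - 1 = sin² · q, the choice w =
  -- sin |sin| q switches sheets at both nodes and is still C¹ because x|x| is. The two halves then
  -- add up instead of cancelling.
  let l : ℝ → ℂ := fun t =>
    (Real.cos (2 * Real.pi * t) : ℂ) + (Real.sin (2 * Real.pi * t) ^ 2 : ℝ) * I
  let q : ℝ → ℂ := fun t =>
    -1 + 2 * I * (Real.cos (2 * Real.pi * t) : ℂ) - (Real.sin (2 * Real.pi * t) : ℂ) ^ 2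
  let w : ℝ → ℂ := fun t =>
    (Real.sin (2 * Real.pi * t) * |Real.sin (2 * Real.pi * t)| : ℝ) * q t
  have hsc : ∀ t : ℝ, (Real.sin (2 * Real.pi * t) : ℂ) ^ 2 +
      (Real.cos (2 * Real.pi * t) : ℂ) ^ 2 = 1 := fun t => by
    exact_mod_cast Real.sin_sq_add_cos_sq (2 * Real.pi * t)
  have hlq : ∀ t, l t ^ 2 - 1 = (Real.sin (2 * Real.pi * t) : ℂ) ^ 2 * q t := fun t => by
    simp only [l, q]
    push_cast [-ofReal_sin, -ofReal_cos]
    linear_combination hsc t + (Real.sin (2 * Real.pi * t) : ℂ) ^ 4 * I_sq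
  have hlin : ContDiff ℝ 1 (fun t : ℝ => 2 * Real.pi * t) := contDiff_const.mul contDiff_id
  have hcos : ContDiff ℝ 1 (fun t : ℝ => (Real.cos (2 * Real.pi * t) : ℂ)) :=
    ofRealCLM.contDiff.comp (Real.contDiff_cos.comp hlin)
  have hsin : ContDiff ℝ 1 (fun t : ℝ => Real.sin (2 * Real.pi * t)) := Real.contDiff_sin.comp hlin
  have hl : ContDiff ℝ 1 l :=
    hcos.add ((ofRealCLM.contDiff.comp (hsin.pow 2)).mul contDiff_const)
  have hq : ContDiff ℝ 1 q :=
    (contDiff_const.add (contDiff_const.mul hcos)).sub ((ofRealCLM.contDiff.comp hsin).pow 2)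
  have hw : ContDiff ℝ 1 w :=
    (ofRealCLM.contDiff.comp (contDiff_mul_abs_self.comp hsin)).mul hq
  have hl0 : ∀ t, l t ≠ 0 := fun t h => by
    have h1 := congrArg re h
    have h2 := congrArg im h
    simp only [l, add_re, add_im, ofReal_re, ofReal_im, re_ofReal_mul, im_ofReal_mul, I_re, I_im,
      mul_zero, mul_one, add_zero, zero_add, zero_re, zero_im] at h1 h2
    have := Real.sin_sq_add_cos_sq (2 * Real.pi * t)
    rw [h1, h2] at this
    norm_num at this
  have hmem : ∀ t, (l t, w t) ∈ curve 2 := fun t => by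
    refine ⟨?_, hl0 t⟩
    have h1 : w t ^ 2 = (l t ^ 2 - 1) ^ 2 := by
      rw [hlq]
      simp only [w]
      rw [mul_pow, mul_pow, ← ofReal_pow, mul_pow, sq_abs]
      push_cast
      ring
    simp only
    rw [h1]
    ring
  have hv0 : l 0 = 1 := by simp [l]
  have hv1 : l 1 = 1 := by simp [l]
  have hvh : l (1 / 2) = -1 := by
    have : 2 * Real.pi * (1 / 2) = Real.pi := by ring
    simp only [l, this]
    simp
  have hw1 : w 1 = w 0 := by simp [w]
  refine ⟨Cycle.ofLoop l w hl hw hmem (hv1.trans hv0.symm) hw1, ?_⟩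
  rw [Cycle.ofLoop_integral]
  have hld : ∀ t, HasDerivAt l (deriv l t) t := fun t =>
    ((hl.differentiable one_ne_zero) t).hasDerivAt
  have hJ : ∀ t, HasDerivAt (fun t => l t + (l t)⁻¹) ((l t ^ 2 - 1) / l t ^ 2 * deriv l t) t :=
    fun t => ((hld t).add ((hld t).fun_inv (hl0 t))).congr_deriv (by
      have := hl0 t
      field_simp
      ring)
  have hcont : Continuous fun t => w t / l t ^ 2 * deriv l t :=
    (hw.continuous.div (hl.continuous.pow 2) fun t => pow_ne_zero 2 (hl0 t)).mul
      (hl.continuous_deriv le_rfl)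
  have hint : ∀ a b : ℝ, IntervalIntegrable (fun t => w t / l t ^ 2 * deriv l t) volume a b :=
    fun a b => hcont.intervalIntegrable a b
  have e1 : ∫ t in (0 : ℝ)..1 / 2, w t / l t ^ 2 * deriv l t = -4 := by
    rw [integral_eq_sub_of_hasDerivAt (f := fun t => l t + (l t)⁻¹) (fun t ht => ?_) (hint _ _),
      hvh, hv0]
    · norm_num
    · rw [uIcc_of_le (by norm_num)] at ht
      have hs : 0 ≤ Real.sin (2 * Real.pi * t) :=
        Real.sin_nonneg_of_nonneg_of_le_pi (by nlinarith [ht.1]) (by nlinarith [ht.2])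
      have : w t = l t ^ 2 - 1 := by
        rw [hlq]
        simp only [w, abs_of_nonneg hs]
        push_cast
        ring
      rw [this]
      exact hJ t
  have e2 : ∫ t in (1 / 2 : ℝ)..1, w t / l t ^ 2 * deriv l t = -4 := by
    rw [integral_eq_sub_of_hasDerivAt (f := fun t => -(l t + (l t)⁻¹)) (fun t ht => ?_) (hint _ _),
      hvh, hv1]
    · norm_num
    · rw [uIcc_of_le (by norm_num)] at ht
      have hs : Real.sin (2 * Real.pi * t) ≤ 0 := by
        rw [← Real.sin_sub_two_pi]
        exact Real.sin_nonpos_of_nonpos_of_neg_pi_le (by nlinarith [ht.2]) (by nlinarith [ht.1])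
      have : w t = -(l t ^ 2 - 1) := by
        rw [hlq]
        simp only [w, abs_of_nonpos hs]
        push_cast
        ring
      rw [this]
      exact (hJ t).neg.congr_deriv (by ring)
  rw [← integral_add_adjacent_intervals (hint 0 (1 / 2)) (hint (1 / 2) 1), e1, e2]
  norm_num

theorem Solves.sin_eq_zero_of_two {φ : ℝ} (h : Solves φ 2) : Real.sin φ = 0 := by
  obtain ⟨c, hc⟩ := exists_nodal_cycle
  have := h c
  rw [hc, exp_mul_im] at this
  simpa using this

/-! ### Equivalence with the two period equations -/

theorem Solves.one_sub {φ : ℝ} {m : ℂ} (h : Solves φ (2 - 4 * m)) :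
    Solves (φ + Real.pi / 2) (2 - 4 * (1 - m)) := by
  convert h.add_pi_div_two using 1
  ring

/-- Conjugating a solution in the lower half-plane gives one above for the angle -φ. By
`exists_angle`, -φ would be congruent modulo π to an angle in (0, π/2), which no φ in [0, π/2]
allows. -/
theorem Solves.im_nonneg {φ : ℝ} {m : ℂ} (hφ : φ ∈ Icc 0 (Real.pi / 2))
    (h : Solves φ (2 - 4 * m)) : 0 ≤ m.im := by
  by_contra! hm
  have h' : Solves (-φ) (2 - 4 * starRingEnd ℂ m) := by
    simpa only [map_sub, map_mul, conj_ofNat] using h.conj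
  have him : 0 < (starRingEnd ℂ m).im := by simpa using hm
  obtain ⟨θ, k, hk, h0, h1, -, -⟩ := exists_angle him
    (h'.re_mul_action (one_sub_mem_slitPlane_of_im_ne_zero him.ne'))
    (h'.im_mul_action (Or.inr him.ne'))
  have hp := Real.pi_pos
  have b1 : (-1 : ℝ) < k := by
    by_contra hcon
    nlinarith [hφ.2]
  have b2 : (k : ℝ) < 0 := by
    by_contra hcon
    nlinarith [hφ.1]
  have b1' : -1 < k := by exact_mod_cast b1
  have b2' : k < 0 := by exact_mod_cast b2
  omega

/-- For x < 0 the unit circle gives sin φ = 0, while the basic cycle, with nonzero real action,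
gives cos φ = 0. -/
theorem Solves.nonneg_of_ofReal {φ x : ℝ} (h : Solves φ (2 - 4 * x)) : 0 ≤ x := by
  by_contra! hx
  have h1 := h.sin_eq_zero hx
  have h2 := h.re_mul_action (Or.inl (by simpa using hx.trans one_pos))
  obtain ⟨r, hr, e⟩ := exists_action_ofReal (hx.trans one_pos)
  rw [e, exp_mul_re, ofReal_re, h1, zero_mul, sub_zero] at h2
  have h3 : Real.cos φ = 0 := (mul_eq_zero.1 h2).resolve_right (mul_neg_of_neg_of_pos hx hr).ne
  have := Real.sin_sq_add_cos_sq φ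
  rw [h1, h3] at this
  norm_num at this

/-- At x = 0 and x = 1 one basic action is zero and the cycle for the other is unavailable; the
nodal loop supplies the missing equation. -/
theorem Solves.isSol_of_ofReal {φ x : ℝ} (h : Solves φ (2 - 4 * x)) : IsSol φ x := by
  have h' : Solves (φ + Real.pi / 2) (2 - 4 * ((1 - x : ℝ) : ℂ)) := by
    simpa using h.one_sub
  rcases h.nonneg_of_ofReal.eq_or_lt with rfl | h0
  · have := Solves.sin_eq_zero_of_two (by simpa using h)
    constructor
    · simp [action_zero]
    · rw [exp_mul_im]; simp [action_one, this]
  rcases (sub_nonneg.1 h'.nonneg_of_ofReal).eq_or_lt with rfl | h1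
  · have := Solves.sin_eq_zero_of_two (by simpa using h')
    rw [Real.sin_add_pi_div_two] at this
    constructor
    · rw [exp_mul_re]; simp [action_one, this]
    · simp [action_zero]
  · exact ⟨h.re_mul_action (Or.inl (by simpa using h1)),
      h.im_mul_action (Or.inl (by simpa using h0))⟩

theorem Solves.isSol {φ : ℝ} {m : ℂ} (hφ : φ ∈ Icc 0 (Real.pi / 2)) (h : Solves φ (2 - 4 * m)) :
    m ∈ halfDisc ∧ IsSol φ m := by
  rcases (h.im_nonneg hφ).eq_or_lt with him | him
  · have hx : m = (m.re : ℂ) := Complex.ext rfl (by simpa using him.symm)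
    generalize m.re = x at hx
    subst hx
    have h0 := h.nonneg_of_ofReal
    have h1 : 0 ≤ 1 - x := Solves.nonneg_of_ofReal (φ := φ + Real.pi / 2) (by simpa using h.one_sub)
    refine ⟨⟨?_, him.le⟩, h.isSol_of_ofReal⟩
    rw [normSq_ofReal, ofReal_re]
    nlinarith
  · have hs : IsSol φ m := ⟨h.re_mul_action (one_sub_mem_slitPlane_of_im_ne_zero him.ne'),
      h.im_mul_action (Or.inr him.ne')⟩
    obtain ⟨h0, h1, ht⟩ := hs.mem_triangle him hφ
    exact ⟨mem_halfDisc_of_mem_triangle ⟨h0, h1⟩ ht, hs⟩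

theorem IsSol.solves {φ : ℝ} (hφ : φ ∈ Icc 0 (Real.pi / 2)) {m : ℂ} (hm : m ∈ halfDisc)
    (h : IsSol φ m) : Solves φ (2 - 4 * m) := by
  rcases hφ.1.eq_or_lt with rfl | h0
  · rw [h.eq hφ isSol_zero hm (by simp [halfDisc])]
    simpa using solves_zero_two
  rcases hφ.2.eq_or_lt with rfl | h1
  · rw [h.eq hφ isSol_pi_div_two hm (by simp [halfDisc])]
    convert solves_zero_two.add_pi_div_two using 1 <;> norm_num
  · have ht := h.mem_triangle_of_mem_Ioo hm ⟨h0, h1⟩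
    exact solves_of_action ht.1.ne' (normSq_lt_of_mem_triangle h0 h1 ht) h.1 h.2

/-! ### The function A and its regularity -/

theorem solves_add_pi_div_two_iff {φ : ℝ} {a : ℂ} : Solves (φ + Real.pi / 2) (-a) ↔ Solves φ a :=
  ⟨fun h => by simpa using h.sub_pi_div_two, Solves.add_pi_div_two⟩

theorem existsUnique_solves (φ : ℝ) : ∃! a, Solves φ a := by
  -- Negation is a bijection between the solutions at φ and at φ + π/2, so only angles in [0, π/2)
  -- have to be treated.
  have hper : Function.Periodic (fun φ => ∃! a, Solves φ a) (Real.pi / 2) := fun φ => by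
    refine propext ((Equiv.neg ℂ).existsUnique_congr fun {a} => ?_)
    rw [Equiv.neg_apply, ← solves_add_pi_div_two_iff (φ := φ), neg_neg]
  obtain ⟨x, hx, e⟩ := hper.exists_mem_Ico₀ (half_pos Real.pi_pos) φ
  refine e ▸ ?_
  have hx' := Ico_subset_Icc_self hx
  obtain ⟨m, hm, hs⟩ := exists_isSol_of_mem_Icc hx'
  refine ⟨2 - 4 * m, hs.solves hx' hm, fun a ha => ?_⟩
  have e : a = 2 - 4 * ((2 - a) / 4) := by ring
  rw [e] at ha ⊢
  obtain ⟨hD, hS⟩ := ha.isSol hx'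
  rw [hS.eq hx' hs hD hm]

theorem exists_eq_of_solves {A : ℝ → ℂ} (hA : ∀ φ, Solves φ (A φ)) :
    ∃ M : ℝ → ℂ, (∀ φ, A φ = 2 - 4 * M φ) ∧
      ∀ φ ∈ Icc 0 (Real.pi / 2), M φ ∈ halfDisc ∧ IsSol φ (M φ) := by
  have e : ∀ φ, A φ = 2 - 4 * ((2 - A φ) / 4) := fun φ => by ring
  exact ⟨_, e, fun φ hφ => Solves.isSol hφ (e φ ▸ hA φ)⟩

theorem contDiffAt_of_mem_Ioo {A : ℝ → ℂ} (hA : ∀ φ, Solves φ (A φ)) {φ : ℝ}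
    (hφ : φ ∈ Ioo 0 (Real.pi / 2)) : ContDiffAt ℝ ∞ A φ := by
  obtain ⟨M, e, hM⟩ := exists_eq_of_solves hA
  have hφ' := hM φ (Ioo_subset_Icc_self hφ)
  obtain ⟨ψ, hψ, hev⟩ := hφ'.2.exists_branch hφ.1 hφ.2
    (hφ'.2.mem_triangle_of_mem_Ioo hφ'.1 hφ)
  refine (contDiffAt_const.sub (contDiffAt_const.mul hψ) :
    ContDiffAt ℝ ∞ (fun x => (2 : ℂ) - 4 * ψ x) φ).congr_of_eventuallyEq ?_
  filter_upwards [hev, isOpen_Ioo.mem_nhds hφ] with x hx hx2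
  have hxI := Ioo_subset_Icc_self hx2
  rw [e, (hM x hxI).2.eq hxI hx.1 (hM x hxI).1
    (mem_halfDisc_of_mem_triangle hx2 (hx.1.mem_triangle hx.2 hxI).2.2)]

theorem continuousOn_of_solves {A : ℝ → ℂ} (hA : ∀ φ, Solves φ (A φ)) :
    ContinuousOn A (Icc 0 (Real.pi / 2)) := by
  obtain ⟨M, e, hM⟩ := exists_eq_of_solves hA
  rw [funext e]
  exact continuousOn_const.sub (continuousOn_const.mul (continuousOn_of_isSol hM))

theorem continuous_of_solves {A : ℝ → ℂ} (hA : ∀ φ, Solves φ (A φ))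
    (hadd : ∀ φ, A (φ + Real.pi / 2) = -A φ) (hneg : ∀ φ, A (-φ) = starRingEnd ℂ (A φ)) :
    Continuous A := by
  have hp := half_pos Real.pi_pos
  have hper : Function.Periodic (fun φ => ContinuousAt A φ) (Real.pi / 2) := fun φ => by
    refine propext ⟨fun h => ?_, fun h => ?_⟩
    · have : ContinuousAt (fun x => -A (x + Real.pi / 2)) φ :=
        (ContinuousAt.comp (g := A) (f := fun x => x + Real.pi / 2) h (by fun_prop)).neg
      simpa only [hadd, neg_neg] using this
    · have : ContinuousAt (fun x => -A (x - Real.pi / 2)) (φ + Real.pi / 2) :=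
        (ContinuousAt.comp (g := A) (f := fun x => x - Real.pi / 2) (by simpa using h)
          (by fun_prop)).neg
      simpa only [← hadd, sub_add_cancel] using this
  have hc := continuousOn_of_solves hA
  refine continuous_iff_continuousAt.2 fun φ => ?_
  obtain ⟨x, hx, e⟩ := hper.exists_mem_Ico₀ hp φ
  refine e ▸ ?_
  rcases hx.1.eq_or_lt with rfl | h0
  · have hr : ContinuousWithinAt A (Ici 0) 0 :=
      (hc 0 ⟨le_rfl, hp.le⟩).mono_of_mem_nhdsWithin (Icc_mem_nhdsGE hp)
    -- Left continuity at 0 is right continuity transported by A(-φ) = conj A(φ).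
    refine continuousAt_iff_continuous_left_right.2 ⟨?_, hr⟩
    have hl : ContinuousWithinAt (fun x => starRingEnd ℂ (A (-x))) (Iic 0) 0 := by
      refine continuous_conj.continuousAt.comp_continuousWithinAt ?_
      refine ContinuousWithinAt.comp (g := A) (t := Ici 0) (by simpa using hr)
        continuous_neg.continuousWithinAt fun x hx => ?_
      simpa using hx
    simpa only [hneg, conj_conj] using hl
  · exact hc.continuousAt (Icc_mem_nhds h0 hx.2)

theorem contDiffAt_of_solves {A : ℝ → ℂ} (hA : ∀ φ, Solves φ (A φ))
    (hadd : ∀ φ, A (φ + Real.pi / 2) = -A φ) {φ : ℝ} (hφ : ∀ m : ℤ, φ ≠ m * (Real.pi / 2)) :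
    ContDiffAt ℝ ∞ A φ := by
  -- Shift into [0, π/2); excluding multiples of π/2 rules out the left end, and antiperiodicity
  -- changes A only by a sign.
  obtain ⟨n, hn, -⟩ := existsUnique_add_zsmul_mem_Ico (half_pos Real.pi_pos) φ 0
  rw [zero_add, zsmul_eq_mul] at hn
  have hanti : Function.Antiperiodic A (Real.pi / 2) := hadd
  have hshift : ∀ x, A x = (n.negOnePow : ℤ) • A (x + n * (Real.pi / 2)) := fun x => by
    rw [← zsmul_eq_mul, hanti.add_zsmul_eq, smul_smul]
    simp
  have h0 : φ + n * (Real.pi / 2) ≠ 0 := fun h => hφ (-n) (by push_cast; linarith)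
  have := contDiffAt_of_mem_Ioo hA ⟨lt_of_le_of_ne hn.1 h0.symm, hn.2⟩
  rw [funext hshift]
  exact (ContDiffAt.comp (g := A) φ this (by fun_prop)).const_smul _

end Boutroux

end

theorem proposition8p15 :
    ∃ A : ℝ → ℂ,
      (∀ φ : ℝ, Boutroux.Solves φ (A φ) ∧ ∀ a : ℂ, Boutroux.Solves φ a → a = A φ) ∧
      (∀ φ : ℝ, A (φ + Real.pi / 2) = -A φ) ∧
      (∀ φ : ℝ, A (φ - Real.pi / 2) = -A φ) ∧
      (∀ φ : ℝ, A (φ + Real.pi) = A φ) ∧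
      (∀ φ : ℝ, A (-φ) = (starRingEnd ℂ) (A φ)) ∧
      A 0 = 2 ∧ A (Real.pi / 2) = -2 ∧ A (-(Real.pi / 2)) = -2 ∧
      Continuous A ∧
      ContDiffOn ℝ ∞ A {φ : ℝ | ∀ m : ℤ, φ ≠ m * (Real.pi / 2)} := by
  choose A hA hu using Boutroux.existsUnique_solves
  have hadd : ∀ φ, A (φ + Real.pi / 2) = -A φ := fun φ => (hu _ _ (hA φ).add_pi_div_two).symm
  have hneg : ∀ φ, A (-φ) = starRingEnd ℂ (A φ) := fun φ => (hu _ _ (hA φ).conj).symm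
  have h0 : A 0 = 2 := (hu 0 2 Boutroux.solves_zero_two).symm
  have h1 : A (Real.pi / 2) = -2 := by simpa [h0] using hadd 0
  refine ⟨A, fun φ => ⟨hA φ, hu φ⟩, hadd, fun φ => (hu _ _ (hA φ).sub_pi_div_two).symm,
    fun φ => (hu _ _ (hA φ).add_pi).symm, hneg, h0, h1,
    by rw [hneg, h1, map_neg, Complex.conj_ofNat],
    Boutroux.continuous_of_solves hA hadd hneg, fun φ hφ => ?_⟩
  exact (Boutroux.contDiffAt_of_solves hA hadd hφ).contDiffWithinAt
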